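/- Setting. Fix an order $N$. Tensors in $\mathbb R^{d\times\cdots\times d}$ ($N$ modes) carry the entrywise inner product and the Frobenius norm $\|\cdot\|_F$; $\mathcal M_n$ denotes the mode-$n$ matricization. At each step $t=1,\dots,T$ a player sees a set of actions $\mathbb A_t\subseteq\{\mathcal A:\|\mathcal A\|_F\le 1\}$, pulls $\mathcal A_t\in\mathbb A_t$ and observes $r_t=\langle\mathcal A_t,\mathcal X\rangle+\varepsilon_t$, where $\varepsilon_t$ is $1$-sub-Gaussian and independent of the past (including $\mathcal A_t$). The regret is $R(T)=\sum_{t=1}^T\big(\sup_{\mathcal A\in\mathbb A_t}\langle\mathcal A,\mathcal X\rangle-\langle\mathcal A_t,\mathcal X\rangle\big)$. The unknown tensor satisfies $\|\mathcal X\|_F\le C$ with $0<C\le\sqrt T$, has multilinear rank $(r,\dots,r)$ (that is, $\operatorname{rank}\mathcal M_n(\mathcal X)=r$ for all $n$), and the smallest positive singular value of every $\mathcal M_n(\mathcal X)$ is at least $\omega>0$. Algorithm TOFU, with inputs $\rho\in\{1,\dots,N\}$, $T_1\le T$, $\delta\in(0,1)$. Phase A ($t\le T_1$): arbitrary actions are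 pulled; from the information collected, an estimate $\hat{\mathcal X}=[[\hat{\mathcal G};\hat U_1,\dots,\hat U_N]]$ in Tucker form is computed, with $\hat{\mathcal G}\in\mathbb R^{r\times\cdots\times r}$ and each $\hat U_n\in\mathbb R^{d\times r}$ having orthonormal columns, which $\hat U_{n,\perp}$ completes to an orthonormal basis of $\mathbb R^d$. Actions are then projected to $\hat{\boldsymbol b}=\operatorname{vec}\big(\mathcal A\times_{n\in[N]}[\hat U_n,\hat U_{n,\perp}]^\top\big)\in\mathbb R^{d^N}$. Let $q(\rho)=\sum_{i=0}^{\rho-1}\binom Ni r^{N-i}(d-r)^i$, the number of coordinates with fewer than $\rho$ mode indices in $\{r+1,\dots,d\}$, and put $$\lambda=C^{-2},\qquad \lambda_\perp=\frac{T}{q(\rho)\log(1+T/\lambda)},\qquad C_\perp=2^{N/2}C\,\eta(T_1)^\rho\omega^{-\rho},$$ where $\eta(T_1)\le\omega$ is the error level of the estimate. Let $\Lambda$ be the diagonal matrix with entry $\lambda$ on those $q(\rho)$ coordinates and $\lambda_\perp$ on the others. Phase B ($T_1<t\le T$): pull an action whose projection $\hat{\boldsymbol b}_t$ maximizes $\max_{\boldsymbol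 y\in\Psi_{t-1}}\langle\hat{\boldsymbol b},\boldsymbol y\rangle$ over the projected actions, where $\Psi_{T_1}=\{\|\boldsymbol y\|_2\le C\}$ and, for $t>T_1$, with $V_t=\Lambda+\sum_{T_1<\tau\le t}\hat{\boldsymbol b}_\tau\hat{\boldsymbol b}_\tau^\top$ and $\bar{\boldsymbol y}_t=V_t^{-1}\sum_{T_1<\tau\le t}r_\tau\hat{\boldsymbol b}_\tau$, $$\Psi_t=\Big\{\boldsymbol y:\|\boldsymbol y-\bar{\boldsymbol y}_t\|_{V_t}\le\sqrt{\log\tfrac{\det V_t}{\det(\Lambda)\,\delta^2}}+\sqrt\lambda\,C+\sqrt{\lambda_\perp}\,C_\perp\Big\}.$$ Theorem. There are constants $K>0$ and $p\in\mathbb N$ depending only on $N$ such that, in the setting above, with probability at least $1-\delta$: if $\|\hat{\mathcal X}-\mathcal X\|_F\le\eta(T_1)$ then $$R(T)\le K\big(1+\log T+\log\tfrac1\delta\big)^p\Big(C\,T_1+d^{\rho-1}r^{N-\rho+1}\sqrt T+C\,\eta(T_1)^\rho\,\omega^{-\rho}\,T\Big).$$ In particular, if $\|\hat{\mathcal X}-\mathcal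 X\|_F\le\eta(T_1)$ holds almost surely, then this regret bound, i.e. $R(T)\le\tilde O\big(CT_1+d^{\rho-1}r^{N-\rho+1}\sqrt T+C\eta(T_1)^\rho\omega^{-\rho}T\big)$, holds with probability at least $1-\delta$. -/

import Mathlib

open MeasureTheory ProbabilityTheory
open scoped Matrix RealInnerProductSpace

noncomputable section

namespace TensorBandit

/-- Real order-`N` tensors all of whose modes are indexed by `ι`. The norm is the Frobenius norm and
the inner product is the entrywise one. Since the entries are indexed by `Fin N → ι`, such a tensor
is at the same time its own vectorization. -/
abbrev Tensor (N : ℕ) (ι : Type*) [Fintype ι] := EuclideanSpace ℝ (Fin N → ι)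

/-- The product `Y ×₁ B 1 ×₂ B 2 ⋯ ×_N B N` of a tensor with one matrix along every mode. -/
def multiModeProd {N : ℕ} {ι κ : Type*} [Fintype ι] [Fintype κ]
    (Y : Tensor N κ) (B : Fin N → Matrix ι κ ℝ) : Tensor N ι :=
  WithLp.toLp 2 fun i => ∑ j : Fin N → κ, (∏ n, B n (i n) (j n)) * Y j

/-- The mode-`n` matricization: the columns are the mode-`n` fibers. -/
def matricize {N d : ℕ} (n : Fin N) (Y : Tensor N (Fin d)) :
    Matrix (Fin d) ({m : Fin N // m ≠ n} → Fin d) ℝ :=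
  Matrix.of fun a j => Y fun m => if h : m = n then a else j ⟨m, h⟩

/-- The tensor has multilinear rank `(r, …, r)`. -/
def HasMultilinearRank {N d : ℕ} (X : Tensor N (Fin d)) (r : ℕ) : Prop :=
  ∀ n, (matricize n X).rank = r

/-- The minimum positive singular value of a (nonzero) real matrix. -/
def minPosSingularValue {m n : Type*} [Fintype m] [Fintype n] [DecidableEq n]
    (M : Matrix m n ℝ) : ℝ :=
  sInf {s : ℝ | 0 < s ∧ ∃ i : ℕ, (Matrix.toEuclideanLin M).singularValues i = s}

/-- A Tucker-form estimate `[[core; U 1, …, U N]]` with core of size `(r, …, r)`, together with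
matrices `Uperp n` whose columns complete the columns of `U n` to an orthonormal basis. -/
structure TuckerEstimate (N d r : ℕ) where
  core : Tensor N (Fin r)
  U : Fin N → Matrix (Fin d) (Fin r) ℝ
  Uperp : Fin N → Matrix (Fin d) (Fin (d - r)) ℝ
  orthonormal : ∀ n, (Matrix.fromCols (U n) (Uperp n))ᵀ * Matrix.fromCols (U n) (Uperp n) = 1

/-- The estimated tensor `core ×₁ U 1 ⋯ ×_N U N`. -/
def TuckerEstimate.tensor {N d r : ℕ} (E : TuckerEstimate N d r) : Tensor N (Fin d) :=
  multiModeProd E.core E.U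

/-- The index set of a mode of a projected tensor: `Fin r` is the head, `Fin (d - r)` the tail. -/
abbrev Mode (d r : ℕ) := Fin r ⊕ Fin (d - r)

/-- The projection `A ×₁ [U 1, Uperp 1]ᵀ ⋯ ×_N [U N, Uperp N]ᵀ`. -/
def TuckerEstimate.project {N d r : ℕ} (E : TuckerEstimate N d r) (A : Tensor N (Fin d)) :
    Tensor N (Mode d r) :=
  multiModeProd A fun n => (Matrix.fromCols (E.U n) (E.Uperp n))ᵀ

/-- The number of modes in which an index of a projected tensor lies in the tail. -/
def tails {N d r : ℕ} (i : Fin N → Mode d r) : ℕ :=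
  (Finset.univ.filter fun n => (i n).isRight = true).card

/-- The number of entries of a projected tensor with fewer than `k` tails. -/
def qCount (N d r k : ℕ) : ℕ :=
  ∑ i ∈ Finset.range k, N.choose i * r ^ (N - i) * (d - r) ^ i

/-- The regularizer `λ = C⁻²`. -/
def lam (C : ℝ) : ℝ := (C ^ 2)⁻¹

/-- The regularizer `λ_⊥ = T / (q(ρ) log (1 + T / λ))`. -/
def lamPerp (N d r ρ T : ℕ) (C : ℝ) : ℝ :=
  T / (qCount N d r ρ * Real.log (1 + T / lam C))

/-- The norm bound `C_⊥ = 2^(N/2) C e^ρ ω^(-ρ)`, where `e` is the estimation error. -/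
def Cperp (N ρ : ℕ) (C e ω : ℝ) : ℝ :=
  (2 : ℝ) ^ ((N : ℝ) / 2) * C * e ^ ρ * (ω ^ ρ)⁻¹

/-- The diagonal regularization matrix `Λ(ρ)`: it is `l` on the entries with fewer than `ρ` tails
and `lp` on the others. -/
def regMatrix {N d r : ℕ} (ρ : ℕ) (l lp : ℝ) :
    Matrix (Fin N → Mode d r) (Fin N → Mode d r) ℝ :=
  Matrix.diagonal fun i => if tails i < ρ then l else lp

section LowOFUL

variable {ι : Type*} [Fintype ι] [DecidableEq ι]

/-- The matrix whose rows are the action vectors `b τ`, `T1 < τ ≤ t`. -/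
def designMatrix (T1 : ℕ) (b : ℕ → EuclideanSpace ℝ ι) (t : ℕ) :
    Matrix (Finset.Ioc T1 t) ι ℝ :=
  Matrix.of fun τ i => b τ i

/-- `V_t = Λ + B_tᵀ B_t`. -/
def gram (Λ : Matrix ι ι ℝ) (T1 : ℕ) (b : ℕ → EuclideanSpace ℝ ι) (t : ℕ) : Matrix ι ι ℝ :=
  Λ + (designMatrix T1 b t)ᵀ * designMatrix T1 b t

/-- The weighted ridge estimate `V_t⁻¹ B_tᵀ r_t`. -/
def ridge (Λ : Matrix ι ι ℝ) (T1 : ℕ) (b : ℕ → EuclideanSpace ℝ ι) (rew : ℕ → ℝ) (t : ℕ) :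
    ι → ℝ :=
  (gram Λ T1 b t)⁻¹ *ᵥ ((designMatrix T1 b t)ᵀ *ᵥ fun τ => rew τ)

/-- The radius `√β_t = √(log (det V_t / (det Λ δ²))) + √l C + √lp Cp`. -/
def sqrtBeta (Λ : Matrix ι ι ℝ) (T1 : ℕ) (b : ℕ → EuclideanSpace ℝ ι) (δ l lp C Cp : ℝ)
    (t : ℕ) : ℝ :=
  √(Real.log ((gram Λ T1 b t).det / (Λ.det * δ ^ 2))) + √l * C + √lp * Cp

/-- The confidence set `Ψ_t`: the ball of radius `C` at the end of the first phase (`t = T1`), and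
the ellipsoid `‖y - ridge‖_{V_t} ≤ √β_t` afterwards. -/
def confSet (Λ : Matrix ι ι ℝ) (T1 : ℕ) (b : ℕ → EuclideanSpace ℝ ι) (rew : ℕ → ℝ)
    (δ l lp C Cp : ℝ) (t : ℕ) : Set (EuclideanSpace ℝ ι) :=
  if t ≤ T1 then {y | ‖y‖ ≤ C}
  else {y | √((y.ofLp - ridge Λ T1 b rew t) ⬝ᵥ
      (gram Λ T1 b t *ᵥ (y.ofLp - ridge Λ T1 b rew t))) ≤ sqrtBeta Λ T1 b δ l lp C Cp t}

/-- The optimistic value `max_{y ∈ Ψ} ⟨b, y⟩` of the action vector `b`. -/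
def optimisticValue (Ψ : Set (EuclideanSpace ℝ ι)) (b : EuclideanSpace ℝ ι) : ℝ :=
  sSup ((fun y => ⟪b, y⟫) '' Ψ)

end LowOFUL

/-- One realized trajectory of the two-phase algorithm TOFU: `acts t` is the action set of step `t`,
`A t` the pulled action, `rew t` the observed reward, `E` the estimate computed at the end of
Phase A, and `e` the error level that enters `C_⊥`. In Phase A (steps `1, …, T1`) the actions are
arbitrary elements of the action sets. In Phase B (steps `T1 + 1, …, T`) the pulled action maximizes
the optimistic value of the projected action over the confidence set of the previous step. -/
structure IsTOFURun {N d r : ℕ} (ρ T T1 : ℕ) (C ω δ e : ℝ)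
    (acts : ℕ → Set (Tensor N (Fin d))) (A : ℕ → Tensor N (Fin d)) (rew : ℕ → ℝ)
    (E : TuckerEstimate N d r) : Prop where
  mem : ∀ t ∈ Finset.Icc 1 T, A t ∈ acts t
  optimistic : ∀ t ∈ Finset.Icc (T1 + 1) T,
    IsMaxOn
      (fun B => optimisticValue
        (confSet (regMatrix ρ (lam C) (lamPerp N d r ρ T C)) T1 (fun τ => E.project (A τ)) rew
          δ (lam C) (lamPerp N d r ρ T C) C (Cperp N ρ C e ω) (t - 1))
        (E.project B))
      (acts t) (A t)

/-- The stochastic protocol over the steps `1, …, T` with information `ℱ t` available after step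
`t`: the pulled action is determined by the past (and the player's own randomization), the noise is
`1`-sub-Gaussian and independent of the past, and the estimate is determined by the
information collected in Phase A. -/
structure IsProtocol {N d r : ℕ} {Ω : Type*} [mΩ : MeasurableSpace Ω] (μ : Measure Ω)
    (ℱ : Filtration ℕ mΩ) (T T1 : ℕ) (A : ℕ → Ω → Tensor N (Fin d)) (ε : ℕ → Ω → ℝ)
    (E : Ω → TuckerEstimate N d r) : Prop where
  action_measurable : ∀ t ∈ Finset.Icc 1 T, Measurable[ℱ (t - 1)] (A t)
  noise_measurable : ∀ t ∈ Finset.Icc 1 T, Measurable[ℱ t] (ε t)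
  noise_indep : ∀ t ∈ Finset.Icc 1 T,
    Indep (MeasurableSpace.comap (ε t) inferInstance) (ℱ (t - 1)) μ
  noise_subgaussian : ∀ t ∈ Finset.Icc 1 T, HasSubgaussianMGF (ε t) 1 μ
  core_measurable : Measurable[ℱ T1] fun w => (E w).core
  U_measurable : ∀ n i j, Measurable[ℱ T1] fun w => (E w).U n i j
  Uperp_measurable : ∀ n i j, Measurable[ℱ T1] fun w => (E w).Uperp n i j

/-- The regret of the actions `A 1, …, A T` against the best action of every step. -/
def regret {N d : ℕ} (X : Tensor N (Fin d)) (T : ℕ) (acts : ℕ → Set (Tensor N (Fin d)))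
    (A : ℕ → Tensor N (Fin d)) : ℝ :=
  ∑ t ∈ Finset.Icc 1 T, (sSup ((fun B => ⟪B, X⟫) '' acts t) - ⟪A t, X⟫)

end TensorBandit

end

/-!
The parameter of the linear bandit of the second phase is the projected tensor `y = E.project X`.
Projection is an isometry, so rewards, norms and regrets can be computed with `y` and with the
projected actions.

*The projected tensor is small outside the first `q(ρ)` entries.* The complement `Uperp n`
annihilates the mode-`n` column space of the estimate. Each vector of the mode-`n` column space of
`X` has a preimage under the matricization that is at most `ω⁻¹` times as long, so `Uperp n`
contracts that space by `η / ω` (`dotProduct_Uperp_transpose_unfolding_le`). An entry with at least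
`ρ` tails is contracted in this way along `ρ` modes, which gives the norm bound `C_⊥`
(`sum_sq_project_le_Cperp`).

*The confidence sets contain `y` with probability at least `1 - δ`.* With `S_t = ∑ ε_τ b_τ`, the
process `√(det Λ / det V_t) exp (½ S_tᵀ V_t⁻¹ S_t)` is a supermartingale, and Ville's inequality
bounds it at all steps at once (`measure_not_noiseConcentrated_le`). It is a Gaussian mixture of
exponential supermartingales, but no multivariate Gaussian integral is needed: one step changes
`V_t` by a matrix of rank one, so that the Sherman–Morrison formula reduces the supermartingale
property to a one-dimensional mixture (`lintegral_exp_quad_le`). The radius of the confidence set is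
the sum of the resulting bound on `‖S_t‖_{V_t⁻¹}` and of the bias bound
`‖y‖_Λ ≤ √λ C + √λ_⊥ C_⊥` (`mem_confSet`).

*The regret is controlled by the log-determinant.* An optimistic step costs at most twice the
confidence width, and the squared widths are summed by the elliptical potential identity
(`sum_log_one_add_quadForm`). Comparing `V_t` with a suitable diagonal matrix gives
`log (det V_t / det Λ) ≤ q(ρ) log (1 + T / λ) + T / λ_⊥` (`log_det_gram_div_le`), so the ambient
dimension `d ^ N` never enters, and the value of `λ_⊥` makes the two summands equal. Steps of large
width, and the step `T1 + 1`, where the confidence set is only a ball, are charged the trivial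
regret `2 C` (`sum_le_of_le_min`); this is affordable because `C ≤ √T`.
-/

namespace TensorBandit

/-! ### Rank-one updates and determinants of positive definite matrices -/

section RankOne

variable {ι : Type*} [Fintype ι]

lemma mulVec_vecMulVec_add {V : Matrix ι ι ℝ} (b x : ι → ℝ) :
    (V + Matrix.vecMulVec b b) *ᵥ x = V *ᵥ x + (b ⬝ᵥ x) • b := by
  rw [Matrix.add_mulVec, Matrix.vecMulVec_mulVec]
  ext i
  simp [mul_comm]

lemma dotProduct_mulVec_symm {V : Matrix ι ι ℝ} (hV : V.IsHermitian) (x y : ι → ℝ) :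
    x ⬝ᵥ (V *ᵥ y) = y ⬝ᵥ (V *ᵥ x) := by
  have h : Vᵀ = V := by simpa [Matrix.IsSymm] using hV
  rw [Matrix.dotProduct_mulVec, ← Matrix.mulVec_transpose, h, dotProduct_comm]

lemma posDef_add_vecMulVec {V : Matrix ι ι ℝ} (hV : V.PosDef) (b : ι → ℝ) :
    (V + Matrix.vecMulVec b b).PosDef := by
  have h := Matrix.posSemidef_vecMulVec_self_star b
  simp only [star_trivial] at h
  exact hV.add_posSemidef h

variable [DecidableEq ι]

lemma det_add_vecMulVec {V : Matrix ι ι ℝ} (hV : IsUnit V.det) (b : ι → ℝ) :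
    (V + Matrix.vecMulVec b b).det = V.det * (1 + b ⬝ᵥ (V⁻¹ *ᵥ b)) := by
  have h := Matrix.det_add_replicateCol_mul_replicateRow (ι := Unit) hV b b
  rw [← Matrix.vecMulVec_eq] at h
  rw [h]
  congr 1
  rw [Matrix.det_unique, Matrix.mul_assoc, ← Matrix.replicateCol_mulVec]
  simp [Matrix.mul_apply, dotProduct]

/-- The change of the quadratic form `S ⬝ᵥ V⁻¹ S` when `V` becomes `V + b bᵀ` and `S` becomes
`S + e b` (a Sherman–Morrison computation). -/
lemma inv_quadForm_add_vecMulVec {V : Matrix ι ι ℝ} (hV : V.PosDef) (b S : ι → ℝ) (e : ℝ) :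
    (S + e • b) ⬝ᵥ ((V + Matrix.vecMulVec b b)⁻¹ *ᵥ (S + e • b)) =
      S ⬝ᵥ (V⁻¹ *ᵥ S) + (2 * e * (b ⬝ᵥ (V⁻¹ *ᵥ S)) + e ^ 2 * (b ⬝ᵥ (V⁻¹ *ᵥ b))
        - (b ⬝ᵥ (V⁻¹ *ᵥ S)) ^ 2) / (1 + b ⬝ᵥ (V⁻¹ *ᵥ b)) := by
  have hV' := posDef_add_vecMulVec hV b
  have hu : 0 ≤ b ⬝ᵥ (V⁻¹ *ᵥ b) := by
    simpa using hV.inv.posSemidef.dotProduct_mulVec_nonneg b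
  have hsymm := dotProduct_mulVec_symm hV.inv.isHermitian S b
  have hdet : IsUnit V.det := hV.det_pos.ne'.isUnit
  have hdet' : IsUnit (V + Matrix.vecMulVec b b).det := hV'.det_pos.ne'.isUnit
  set u := b ⬝ᵥ (V⁻¹ *ᵥ b) with hu'
  set m := b ⬝ᵥ (V⁻¹ *ᵥ S) with hm
  have key : (V + Matrix.vecMulVec b b)⁻¹ *ᵥ (S + e • b) =
      V⁻¹ *ᵥ S + ((e - m) / (1 + u)) • (V⁻¹ *ᵥ b) := by
    -- `(V + b bᵀ)⁻¹ (S + e b)` lies in `V⁻¹ S + ℝ V⁻¹ b`; the coefficient solves the equation.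
    have h1 : (V + Matrix.vecMulVec b b) *ᵥ (V⁻¹ *ᵥ S + ((e - m) / (1 + u)) • (V⁻¹ *ᵥ b)) =
        S + e • b := by
      rw [mulVec_vecMulVec_add, Matrix.mulVec_add, Matrix.mulVec_smul, Matrix.mulVec_mulVec,
        Matrix.mulVec_mulVec, Matrix.mul_nonsing_inv _ hdet, Matrix.one_mulVec, Matrix.one_mulVec,
        dotProduct_add, dotProduct_smul, ← hu', ← hm, add_assoc, ← add_smul]
      congr 2
      rw [smul_eq_mul]
      field_simp
      ring
    rw [← h1, Matrix.mulVec_mulVec, Matrix.nonsing_inv_mul _ hdet', Matrix.one_mulVec]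
  rw [key, dotProduct_add, add_dotProduct, add_dotProduct, dotProduct_smul, dotProduct_smul,
    smul_dotProduct, smul_dotProduct, hsymm, ← hu', ← hm]
  simp only [smul_eq_mul]
  field_simp
  ring

/-- `log det M ≤ tr M - n`, in exponential form: apply `1 + x ≤ exp x` to the eigenvalues. -/
lemma det_le_exp_trace_sub_card {M : Matrix ι ι ℝ} (hM : M.PosDef) :
    M.det ≤ Real.exp (M.trace - Fintype.card ι) := by
  have hH := hM.isHermitian
  rw [hH.det_eq_prod_eigenvalues, hH.trace_eq_sum_eigenvalues]
  simp only [RCLike.ofReal_real_eq_id, id_eq]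
  have : ∑ i, hH.eigenvalues i - (Fintype.card ι : ℝ) = ∑ i, (hH.eigenvalues i - 1) := by
    simp
  rw [this, Real.exp_sum]
  refine Finset.prod_le_prod (fun i _ => (hM.eigenvalues_pos i).le) fun i _ => ?_
  have := Real.add_one_le_exp (hH.eigenvalues i - 1)
  linarith

/-- Comparing a positive definite matrix with an arbitrary positive diagonal matrix; this is
Hadamard's inequality when `D` is the diagonal of `V`. -/
lemma det_le_prod_mul_exp {V : Matrix ι ι ℝ} (hV : V.PosDef) (D : ι → ℝ) (hD : ∀ i, 0 < D i) :
    V.det ≤ (∏ i, D i) * Real.exp (∑ i, (V i i / D i - 1)) := by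
  set R : Matrix ι ι ℝ := Matrix.diagonal fun i => (√(D i))⁻¹ with hR
  have hs : ∀ i, 0 < √(D i) := fun i => Real.sqrt_pos.2 (hD i)
  have hRdet : R.det = ∏ i, (√(D i))⁻¹ := by rw [hR, Matrix.det_diagonal]
  have hRu : IsUnit R := by
    rw [Matrix.isUnit_iff_isUnit_det, hRdet]
    exact (Finset.prod_pos fun i _ => inv_pos.2 (hs i)).ne'.isUnit
  have hM : (R * V * R).PosDef := by
    have h := (Matrix.IsUnit.posDef_star_left_conjugate_iff (x := V) hRu).2 hV
    have h2 : star R = R := by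
      rw [hR, Matrix.star_eq_conjTranspose, Matrix.diagonal_conjTranspose]
      simp
    rwa [h2] at h
  have h := det_le_exp_trace_sub_card hM
  have hdet : (R * V * R).det = V.det * (∏ i, D i)⁻¹ := by
    rw [Matrix.det_mul, Matrix.det_mul, hRdet, mul_right_comm, mul_comm, ← Finset.prod_mul_distrib,
      ← Finset.prod_inv_distrib]
    congr 1
    refine Finset.prod_congr rfl fun i _ => ?_
    rw [← mul_inv, Real.mul_self_sqrt (hD i).le]
  have htr : (R * V * R).trace - Fintype.card ι = ∑ i, (V i i / D i - 1) := by
    rw [Finset.sum_sub_distrib]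
    simp only [Matrix.trace, Matrix.diag_apply, hR, Matrix.mul_diagonal, Matrix.diagonal_mul]
    congr 1
    · refine Finset.sum_congr rfl fun i _ => ?_
      rw [mul_right_comm, ← mul_inv, Real.mul_self_sqrt (hD i).le, div_eq_inv_mul]
    · simp
  rw [hdet, htr, ← div_eq_mul_inv, div_le_iff₀ (Finset.prod_pos fun i _ => hD i)] at h
  linarith

end RankOne

/-! ### Gaussian mixtures and Ville's inequality -/

section Mixture

open scoped NNReal ENNReal

lemma lintegral_exp_gaussianReal (m e : ℝ) (u : ℝ≥0) :
    ∫⁻ x, ENNReal.ofReal (Real.exp (e * x - x ^ 2 / 2)) ∂gaussianReal m u =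
      ENNReal.ofReal ((√(1 + u))⁻¹ *
        Real.exp ((2 * e * m + e ^ 2 * u - m ^ 2) / (2 * (1 + u)))) := by
  rcases eq_or_ne u 0 with rfl | hu
  · rw [gaussianReal_zero_var, lintegral_dirac' _ (by fun_prop)]
    simp only [NNReal.coe_zero, add_zero, Real.sqrt_one, inv_one, one_mul, mul_zero, mul_one]
    congr 2
    ring
  · have hu0 : (0 : ℝ) < u := by positivity
    -- Completing the square: the integrand is a multiple of the density of the posterior
    -- `gaussianReal ((m + e u) / (1 + u)) (u / (1 + u))`.
    set v : ℝ≥0 := u / (1 + u) with hv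
    have hvne : v ≠ 0 := by positivity
    set c : ℝ := (√(1 + u))⁻¹ * Real.exp ((2 * e * m + e ^ 2 * u - m ^ 2) / (2 * (1 + u))) with hc
    have hc0 : 0 ≤ c := by positivity
    rw [gaussianReal_of_var_ne_zero _ hu, lintegral_withDensity_eq_lintegral_mul _
      (measurable_gaussianPDF m u) (by fun_prop)]
    have key : ∀ x, (gaussianPDF m u * fun x => ENNReal.ofReal (Real.exp (e * x - x ^ 2 / 2))) x =
        ENNReal.ofReal c * gaussianPDF ((m + e * u) / (1 + u)) v x := by
      intro x
      simp only [Pi.mul_apply, gaussianPDF]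
      rw [← ENNReal.ofReal_mul (gaussianPDFReal_nonneg _ _ _), ← ENNReal.ofReal_mul hc0]
      congr 1
      simp only [gaussianPDFReal, hc, hv, NNReal.coe_div, NNReal.coe_add, NNReal.coe_one]
      have h1 : √(2 * Real.pi * u) = √(1 + u) * √(2 * Real.pi * (u / (1 + u))) := by
        rw [← Real.sqrt_mul (by positivity)]
        congr 1
        field_simp
      rw [h1, mul_inv, mul_mul_mul_comm, mul_assoc, mul_assoc, mul_assoc, ← Real.exp_add,
        ← Real.exp_add]
      have h2 : -(x - m) ^ 2 / (2 * (u : ℝ)) + (e * x - x ^ 2 / 2) =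
          (2 * e * m + e ^ 2 * u - m ^ 2) / (2 * (1 + u)) +
            -(x - (m + e * u) / (1 + u)) ^ 2 / (2 * (u / (1 + u))) := by
        field_simp
        ring
      rw [h2]
      ring_nf
    rw [lintegral_congr key, lintegral_const_mul _ (measurable_gaussianPDF _ _),
      lintegral_gaussianPDF_eq_one _ hvne, mul_one]

/-- The one-dimensional method of mixtures: the integrand is a mixture, with weight
`gaussianReal m u`, of the exponentials `exp (x e - x² / 2)`, whose mean is at most `1`. -/
lemma lintegral_exp_quad_le {Ω : Type*} [MeasurableSpace Ω] {μ : Measure Ω} [IsProbabilityMeasure μ]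
    {X : Ω → ℝ} (hXm : Measurable X) (hX : HasSubgaussianMGF X 1 μ) (m : ℝ) {u : ℝ} (hu : 0 ≤ u) :
    ∫⁻ e, ENNReal.ofReal (Real.exp ((2 * e * m + e ^ 2 * u - m ^ 2) / (2 * (1 + u)))) ∂μ.map X ≤
      ENNReal.ofReal √(1 + u) := by
  lift u to ℝ≥0 using hu
  have : IsProbabilityMeasure (μ.map X) := Measure.isProbabilityMeasure_map hXm.aemeasurable
  have hs : 0 < √(1 + (u : ℝ)) := Real.sqrt_pos.2 (by positivity)
  have h1 : ∀ e : ℝ,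
      ENNReal.ofReal (Real.exp ((2 * e * m + e ^ 2 * u - m ^ 2) / (2 * (1 + u)))) =
      ENNReal.ofReal √(1 + u) *
        ∫⁻ x, ENNReal.ofReal (Real.exp (e * x - x ^ 2 / 2)) ∂gaussianReal m u := by
    intro e
    rw [lintegral_exp_gaussianReal, ← ENNReal.ofReal_mul hs.le, ← mul_assoc,
      mul_inv_cancel₀ hs.ne', one_mul]
  have hmeas : Measurable fun p : ℝ × ℝ => ENNReal.ofReal (Real.exp (p.1 * p.2 - p.2 ^ 2 / 2)) := by
    fun_prop
  rw [lintegral_congr h1, lintegral_const_mul _ hmeas.lintegral_prod_right',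
    lintegral_lintegral_swap hmeas.aemeasurable]
  refine (mul_le_mul_right (?_ : _ ≤ (1 : ℝ≥0∞)) _).trans_eq (mul_one _)
  have h2 : ∀ x : ℝ,
      ∫⁻ e, ENNReal.ofReal (Real.exp (e * x - x ^ 2 / 2)) ∂μ.map X ≤ 1 := by
    intro x
    rw [lintegral_map (by fun_prop) hXm]
    have h3 : ∀ w, ENNReal.ofReal (Real.exp (X w * x - x ^ 2 / 2)) =
        ENNReal.ofReal (Real.exp (-(x ^ 2 / 2))) * ENNReal.ofReal (Real.exp (x * X w)) := by
      intro w
      rw [← ENNReal.ofReal_mul (Real.exp_pos _).le, ← Real.exp_add]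
      congr 2
      ring
    rw [lintegral_congr h3, lintegral_const_mul _ (by fun_prop),
      ← ofReal_integral_eq_lintegral_ofReal (hX.integrable_exp_mul x)
        (ae_of_all _ fun w => (Real.exp_pos _).le), ← ENNReal.ofReal_mul (Real.exp_pos _).le]
    rw [ENNReal.ofReal_le_one]
    calc Real.exp (-(x ^ 2 / 2)) * ∫ w, Real.exp (x * X w) ∂μ
        ≤ Real.exp (-(x ^ 2 / 2)) * Real.exp (x ^ 2 / 2) := by
          gcongr
          simpa [mgf] using hX.mgf_le x
      _ = 1 := by rw [← Real.exp_add]; simp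
  calc ∫⁻ x, ∫⁻ e, ENNReal.ofReal (Real.exp (e * x - x ^ 2 / 2)) ∂μ.map X ∂gaussianReal m u
      ≤ ∫⁻ _, 1 ∂gaussianReal m u := lintegral_mono h2
    _ = 1 := by simp

/-- Integrating out a noise variable that is independent of the past. -/
lemma lintegral_comp_eq_of_indep {Ω α : Type*} {mΩ : MeasurableSpace Ω} [MeasurableSpace α]
    {μ : Measure Ω} [IsProbabilityMeasure μ] {f : Ω → α} {X : Ω → ℝ} (hf : Measurable f)
    (hX : Measurable X) (h : IndepFun f X μ) {g : α × ℝ → ℝ≥0∞} (hg : Measurable g) :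
    ∫⁻ w, g (f w, X w) ∂μ = ∫⁻ w, ∫⁻ e, g (f w, e) ∂μ.map X ∂μ := by
  have : IsProbabilityMeasure (μ.map X) := Measure.isProbabilityMeasure_map hX.aemeasurable
  rw [← lintegral_map (μ := μ) (g := fun w => (f w, X w)) hg (hf.prodMk hX),
    (indepFun_iff_map_prod_eq_prod_map_map hf.aemeasurable hX.aemeasurable).1 h,
    lintegral_prod _ hg.aemeasurable, lintegral_map hg.lintegral_prod_right' hf]

/-- Ville's maximal inequality for nonnegative supermartingales over a finite horizon, the
supermartingale property being stated by integrals over past events. -/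
lemma measure_exists_le_of_supermartingale {Ω : Type*} {mΩ : MeasurableSpace Ω} {μ : Measure Ω}
    {ℱ : Filtration ℕ mΩ} {Z : ℕ → Ω → ℝ≥0∞} {a b : ℕ} (hab : a ≤ b)
    (hZ : ∀ t, a ≤ t → t ≤ b → Measurable[ℱ t] (Z t))
    (hstep : ∀ t, a ≤ t → t < b → ∀ F, MeasurableSet[ℱ t] F →
      ∫⁻ w in F, Z (t + 1) w ∂μ ≤ ∫⁻ w in F, Z t w ∂μ)
    (c : ℝ≥0∞) :
    c * μ {w | ∃ t, a ≤ t ∧ t ≤ b ∧ c ≤ Z t w} ≤ ∫⁻ w, Z a w ∂μ := by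
  have hZ' : ∀ t, a ≤ t → t ≤ b → Measurable (Z t) := fun t h1 h2 =>
    (hZ t h1 h2).mono (ℱ.le t) le_rfl
  set F : ℕ → Set Ω := fun t => {w | ∃ s, a ≤ s ∧ s ≤ t ∧ c ≤ Z s w} with hF
  have hFm : ∀ t, a ≤ t → t ≤ b → MeasurableSet[ℱ t] (F t) := by
    intro t hat htb
    have : F t = ⋃ s ∈ Set.Icc a t, {w | c ≤ Z s w} := by
      ext w
      simp [hF, and_assoc]
    rw [this]
    refine MeasurableSet.biUnion (Set.to_countable _) fun s hs => ?_
    exact ℱ.mono hs.2 _ (hZ s hs.1 (hs.2.trans htb) measurableSet_Ici)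
  have hfirst : ∀ t, a ≤ t → t ≤ b → ∀ G : Set Ω, MeasurableSet G →
      c * μ (G ∩ {w | c ≤ Z t w}) + ∫⁻ w in G \ {w | c ≤ Z t w}, Z t w ∂μ ≤
        ∫⁻ w in G, Z t w ∂μ := by
    intro t hat htb G hG
    have hm : MeasurableSet {w | c ≤ Z t w} := measurableSet_le measurable_const (hZ' t hat htb)
    rw [← lintegral_inter_add_sdiff (Z t) G hm]
    gcongr
    rw [← setLIntegral_const]
    exact setLIntegral_mono' (hG.inter hm) fun w hw => hw.2
  -- Stopping at the first passage above `c`: the mass already stopped and the mass still running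
  -- together never exceed the initial mass.
  have main : ∀ t, a ≤ t → t ≤ b →
      c * μ (F t) + ∫⁻ w in (F t)ᶜ, Z t w ∂μ ≤ ∫⁻ w, Z a w ∂μ := by
    intro t hat
    induction t, hat using Nat.le_induction with
    | base =>
      intro hb
      have h := hfirst a le_rfl hb Set.univ MeasurableSet.univ
      have h2 : F a = {w | c ≤ Z a w} := by
        ext w
        simp only [hF, Set.mem_ofPred_eq]
        exact ⟨fun ⟨s, h1, h2, h3⟩ => le_antisymm h1 h2 ▸ h3, fun h => ⟨a, le_rfl, le_rfl, h⟩⟩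
      simpa [h2, Set.compl_eq_univ_sdiff] using h
    | succ t hat ih =>
      intro hb
      have hFt : MeasurableSet (F t) := ℱ.le t _ (hFm t hat (by omega))
      have hsucc : F (t + 1) = F t ∪ ((F t)ᶜ ∩ {w | c ≤ Z (t + 1) w}) := by
        ext w
        simp only [hF, Set.mem_ofPred_eq, Set.mem_union, Set.mem_inter_iff, Set.mem_compl_iff]
        constructor
        · rintro ⟨s, h1, h2, h3⟩
          by_cases hw : ∃ s, a ≤ s ∧ s ≤ t ∧ c ≤ Z s w
          · exact Or.inl hw
          · refine Or.inr ⟨hw, ?_⟩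
            rcases Nat.le_succ_iff.1 h2 with h | h
            · exact absurd ⟨s, h1, h, h3⟩ hw
            · rwa [h] at h3
        · rintro (⟨s, h1, h2, h3⟩ | ⟨-, h⟩)
          · exact ⟨s, h1, by omega, h3⟩
          · exact ⟨t + 1, by omega, le_rfl, h⟩
      have hcompl : (F (t + 1))ᶜ = (F t)ᶜ \ {w | c ≤ Z (t + 1) w} := by
        rw [hsucc]
        ext w
        simp only [Set.mem_compl_iff, Set.mem_union, Set.mem_inter_iff, Set.mem_sdiff]
        tauto
      calc c * μ (F (t + 1)) + ∫⁻ w in (F (t + 1))ᶜ, Z (t + 1) w ∂μ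
          ≤ c * (μ (F t) + μ ((F t)ᶜ ∩ {w | c ≤ Z (t + 1) w})) +
            ∫⁻ w in (F t)ᶜ \ {w | c ≤ Z (t + 1) w}, Z (t + 1) w ∂μ := by
            rw [hcompl, hsucc]
            gcongr
            exact measure_union_le _ _
        _ = c * μ (F t) + (c * μ ((F t)ᶜ ∩ {w | c ≤ Z (t + 1) w}) +
            ∫⁻ w in (F t)ᶜ \ {w | c ≤ Z (t + 1) w}, Z (t + 1) w ∂μ) := by
            rw [mul_add, add_assoc]
        _ ≤ c * μ (F t) + ∫⁻ w in (F t)ᶜ, Z (t + 1) w ∂μ := by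
            gcongr
            exact hfirst (t + 1) (by omega) hb _ hFt.compl
        _ ≤ c * μ (F t) + ∫⁻ w in (F t)ᶜ, Z t w ∂μ := by
            refine add_le_add le_rfl ?_
            exact hstep t hat (by omega) _ (hFm t hat (by omega)).compl
        _ ≤ _ := ih (by omega)
  exact le_self_add.trans (main b hab le_rfl)

end Mixture

/-! ### Self-normalized concentration -/

section Gram

variable {ι : Type*}

lemma gram_apply (Λ : Matrix ι ι ℝ) (T1 : ℕ) (b : ℕ → EuclideanSpace ℝ ι) (t : ℕ) (i j : ι) :
    gram Λ T1 b t i j = Λ i j + ∑ τ ∈ Finset.Ioc T1 t, b τ i * b τ j := by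
  rw [gram, Matrix.add_apply, Matrix.mul_apply,
    ← Finset.sum_coe_sort (Finset.Ioc T1 t) fun τ => b τ i * b τ j]
  rfl

lemma gram_self (Λ : Matrix ι ι ℝ) (T1 : ℕ) (b : ℕ → EuclideanSpace ℝ ι) :
    gram Λ T1 b T1 = Λ := by
  ext i j
  simp [gram_apply]

lemma gram_succ (Λ : Matrix ι ι ℝ) {T1 : ℕ} (b : ℕ → EuclideanSpace ℝ ι) {t : ℕ} (h : T1 ≤ t) :
    gram Λ T1 b (t + 1) =
      gram Λ T1 b t + Matrix.vecMulVec (b (t + 1)).ofLp (b (t + 1)).ofLp := by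
  ext i j
  rw [Matrix.add_apply, gram_apply, gram_apply, ← Finset.insert_Ioc_right_eq_Ioc_add_one h,
    Finset.sum_insert (by simp), Matrix.vecMulVec_apply]
  ring

/-- The sum `∑ ε_τ b_τ` of the noise over the steps `T1 < τ ≤ t`. -/
noncomputable def noiseSum (T1 : ℕ) (b : ℕ → EuclideanSpace ℝ ι) (ε : ℕ → ℝ) (t : ℕ) : ι → ℝ :=
  ∑ τ ∈ Finset.Ioc T1 t, ε τ • (b τ).ofLp

lemma noiseSum_succ {T1 : ℕ} (b : ℕ → EuclideanSpace ℝ ι) (ε : ℕ → ℝ) {t : ℕ} (h : T1 ≤ t) :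
    noiseSum T1 b ε (t + 1) = noiseSum T1 b ε t + ε (t + 1) • (b (t + 1)).ofLp := by
  rw [noiseSum, ← Finset.insert_Ioc_right_eq_Ioc_add_one h, Finset.sum_insert (by simp), add_comm]
  rfl

lemma measurable_noiseSum {Ω : Type*} {mΩ : MeasurableSpace Ω} {T1 t : ℕ}
    {b : ℕ → Ω → EuclideanSpace ℝ ι} {ε : ℕ → Ω → ℝ}
    (hb : ∀ τ ∈ Finset.Ioc T1 t, Measurable (b τ)) (hε : ∀ τ ∈ Finset.Ioc T1 t, Measurable (ε τ)) :
    Measurable fun w => noiseSum T1 (fun τ => b τ w) (fun τ => ε τ w) t := by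
  refine measurable_pi_lambda _ fun i => ?_
  simp only [noiseSum, Finset.sum_apply, Pi.smul_apply, smul_eq_mul]
  refine Finset.measurable_fun_sum _ fun τ hτ => ?_
  have := hb τ hτ
  have := hε τ hτ
  fun_prop

lemma measurable_gram {Ω : Type*} {mΩ : MeasurableSpace Ω} (Λ : Matrix ι ι ℝ) {T1 t : ℕ}
    {b : ℕ → Ω → EuclideanSpace ℝ ι} (hb : ∀ τ ∈ Finset.Ioc T1 t, Measurable (b τ)) :
    Measurable fun w i j => gram Λ T1 (fun τ => b τ w) t i j := by
  refine measurable_pi_lambda _ fun i => measurable_pi_lambda _ fun j => ?_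
  simp only [gram_apply]
  refine measurable_const.add (Finset.measurable_fun_sum _ fun τ hτ => ?_)
  have := hb τ hτ
  fun_prop

variable [Fintype ι]

lemma gram_posDef {Λ : Matrix ι ι ℝ} (hΛ : Λ.PosDef) (T1 : ℕ) (b : ℕ → EuclideanSpace ℝ ι)
    (t : ℕ) : (gram Λ T1 b t).PosDef := by
  have h := Matrix.posSemidef_conjTranspose_mul_self (designMatrix T1 b t)
  rw [Matrix.conjTranspose_eq_transpose_of_trivial] at h
  exact hΛ.add_posSemidef h

variable [DecidableEq ι]

/-- The value `√(det Λ / det V) exp (½ Sᵀ V⁻¹ S)` of the Gaussian mixture of the exponential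
supermartingales `exp (⟨x, S⟩ - ½ xᵀ (V - Λ) x)`, the covariance of the mixture being `Λ⁻¹`. -/
noncomputable def gaussianMixture (Λ V : Matrix ι ι ℝ) (S : ι → ℝ) : ℝ :=
  √(Λ.det / V.det) * Real.exp (S ⬝ᵥ (V⁻¹ *ᵥ S) / 2)

lemma gaussianMixture_nonneg (Λ V : Matrix ι ι ℝ) (S : ι → ℝ) : 0 ≤ gaussianMixture Λ V S := by
  unfold gaussianMixture
  positivity

lemma measurable_gaussianMixture (Λ : Matrix ι ι ℝ) :
    Measurable fun p : (ι → ι → ℝ) × (ι → ℝ) => gaussianMixture Λ (Matrix.of p.1) p.2 := by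
  have hdet : Measurable fun p : (ι → ι → ℝ) × (ι → ℝ) => (Matrix.of p.1).det :=
    (Continuous.matrix_det
      (continuous_fst : Continuous fun p : (ι → ι → ℝ) × (ι → ℝ) => p.1)).measurable
  have hadj : ∀ i j,
      Measurable fun p : (ι → ι → ℝ) × (ι → ℝ) => (Matrix.of p.1).adjugate i j := fun i j =>
    (Continuous.matrix_elem (Continuous.matrix_adjugate
      (continuous_fst : Continuous fun p : (ι → ι → ℝ) × (ι → ℝ) => p.1)) i j).measurable
  unfold gaussianMixture
  simp only [Matrix.inv_def, Ring.inverse_eq_inv', dotProduct, Matrix.mulVec, Matrix.smul_apply,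
    smul_eq_mul]
  fun_prop

lemma gaussianMixture_add_vecMulVec (Λ : Matrix ι ι ℝ) {V : Matrix ι ι ℝ} (hV : V.PosDef)
    (b S : ι → ℝ) (e : ℝ) :
    gaussianMixture Λ (V + Matrix.vecMulVec b b) (S + e • b) =
      gaussianMixture Λ V S * (√(1 + b ⬝ᵥ (V⁻¹ *ᵥ b)))⁻¹ *
        Real.exp ((2 * e * (b ⬝ᵥ (V⁻¹ *ᵥ S)) + e ^ 2 * (b ⬝ᵥ (V⁻¹ *ᵥ b))
          - (b ⬝ᵥ (V⁻¹ *ᵥ S)) ^ 2) / (2 * (1 + b ⬝ᵥ (V⁻¹ *ᵥ b)))) := by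
  have hu : 0 ≤ b ⬝ᵥ (V⁻¹ *ᵥ b) := by
    simpa using hV.inv.posSemidef.dotProduct_mulVec_nonneg b
  rw [gaussianMixture, inv_quadForm_add_vecMulVec hV, det_add_vecMulVec hV.det_pos.ne'.isUnit,
    ← div_div, Real.sqrt_div' _ (by positivity : 0 ≤ 1 + b ⬝ᵥ (V⁻¹ *ᵥ b)), gaussianMixture,
    add_div, Real.exp_add, div_div, mul_comm (1 + _) (2 : ℝ)]
  ring

open scoped ENNReal in
/-- One step of the supermartingale property. -/
lemma setLIntegral_gaussianMixture_le {Ω : Type*} {m mΩ : MeasurableSpace Ω} (hm : m ≤ mΩ)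
    {μ : Measure Ω} [IsProbabilityMeasure μ] (Λ : Matrix ι ι ℝ)
    {V : Ω → ι → ι → ℝ} {S b : Ω → ι → ℝ} {ε : Ω → ℝ} (hV : Measurable[m] V)
    (hS : Measurable[m] S) (hb : Measurable[m] b) (hpos : ∀ w, (Matrix.of (V w)).PosDef)
    (hεm : Measurable ε) (hind : Indep (MeasurableSpace.comap ε inferInstance) m μ)
    (hsub : HasSubgaussianMGF ε 1 μ) {F : Set Ω} (hF : MeasurableSet[m] F) :
    ∫⁻ w in F, ENNReal.ofReal (gaussianMixture Λ
        (Matrix.of (V w) + Matrix.vecMulVec (b w) (b w)) (S w + ε w • b w)) ∂μ ≤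
      ∫⁻ w in F, ENNReal.ofReal (gaussianMixture Λ (Matrix.of (V w)) (S w)) ∂μ := by
  classical
  -- `f` collects all that the integrand takes from the past, the event `F` included.
  set f : Ω → ℝ≥0∞ × (ι → ι → ℝ) × (ι → ℝ) × (ι → ℝ) :=
    fun w => (F.indicator 1 w, V w, S w, b w) with hf
  have h1m : Measurable[m] (F.indicator (1 : Ω → ℝ≥0∞)) :=
    Measurable.indicator (measurable_const (a := 1)) hF
  have hfm : Measurable[m] f :=
    Measurable.prodMk h1m (hV.prodMk (hS.prodMk hb))
  have hindep : IndepFun f ε μ :=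
    (IndepFun_iff_Indep _ _ _).2 (indep_of_indep_of_le_left hind.symm hfm.comap_le)
  set g : (ℝ≥0∞ × (ι → ι → ℝ) × (ι → ℝ) × (ι → ℝ)) × ℝ → ℝ≥0∞ := fun p =>
    p.1.1 * ENNReal.ofReal (gaussianMixture Λ
      (Matrix.of (fun i j => p.1.2.1 i j + p.1.2.2.2 i * p.1.2.2.2 j))
        (p.1.2.2.1 + p.2 • p.1.2.2.2)) with hg
  have hgm : Measurable g := by
    have h1 : Measurable fun p : (ℝ≥0∞ × (ι → ι → ℝ) × (ι → ℝ) × (ι → ℝ)) × ℝ =>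
        ((fun i j => p.1.2.1 i j + p.1.2.2.2 i * p.1.2.2.2 j, p.1.2.2.1 + p.2 • p.1.2.2.2) :
          (ι → ι → ℝ) × (ι → ℝ)) := by
      fun_prop
    have h2 := (measurable_gaussianMixture Λ).comp h1
    exact (measurable_fst.comp measurable_fst).mul h2.ennreal_ofReal
  have hgval : ∀ w e, g (f w, e) = F.indicator 1 w * ENNReal.ofReal (gaussianMixture Λ
      (Matrix.of (V w) + Matrix.vecMulVec (b w) (b w)) (S w + e • b w)) := fun w e => rfl
  have hFm : MeasurableSet F := hm _ hF
  have hleft := lintegral_comp_eq_of_indep (hfm.mono hm le_rfl) hεm hindep hgm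
  have hind1 : ∀ h : Ω → ℝ≥0∞, ∫⁻ w in F, h w ∂μ = ∫⁻ w, F.indicator 1 w * h w ∂μ := by
    intro h
    rw [← lintegral_indicator hFm]
    refine lintegral_congr fun w => ?_
    by_cases hw : w ∈ F <;> simp [hw]
  rw [hind1, hind1]
  simp only [hgval] at hleft
  rw [hleft]
  refine lintegral_mono fun w => ?_
  have hu : 0 ≤ b w ⬝ᵥ ((Matrix.of (V w))⁻¹ *ᵥ b w) := by
    simpa using (hpos w).inv.posSemidef.dotProduct_mulVec_nonneg (b w)
  have hs : 0 < √(1 + b w ⬝ᵥ ((Matrix.of (V w))⁻¹ *ᵥ b w)) := Real.sqrt_pos.2 (by positivity)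
  set c := gaussianMixture Λ (Matrix.of (V w)) (S w)
    * (√(1 + b w ⬝ᵥ ((Matrix.of (V w))⁻¹ *ᵥ b w)))⁻¹ with hc
  have hc0 : 0 ≤ c := mul_nonneg (gaussianMixture_nonneg _ _ _) (by positivity)
  simp only [gaussianMixture_add_vecMulVec Λ (hpos w), ← hc]
  simp only [ENNReal.ofReal_mul hc0]
  rw [lintegral_const_mul _ (by fun_prop), lintegral_const_mul _ (by fun_prop)]
  refine mul_le_mul_right ?_ _
  calc _ ≤ ENNReal.ofReal c * ENNReal.ofReal √(1 + b w ⬝ᵥ ((Matrix.of (V w))⁻¹ *ᵥ b w)) :=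
        mul_le_mul_right (lintegral_exp_quad_le hεm hsub _ hu) _
    _ = _ := by
        rw [← ENNReal.ofReal_mul hc0, hc, mul_assoc, inv_mul_cancel₀ hs.ne', mul_one]

/-- The noise satisfies `‖S_t‖²_{V_t⁻¹} ≤ log (det V_t / (det Λ δ²))` at every step `T1 ≤ t ≤ T`,
where `S_t = ∑ ε_τ b_τ`. -/
def NoiseConcentrated (Λ : Matrix ι ι ℝ) (T1 T : ℕ) (b : ℕ → EuclideanSpace ℝ ι) (ε : ℕ → ℝ)
    (δ : ℝ) : Prop :=
  ∀ t, T1 ≤ t → t ≤ T →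
    noiseSum T1 b ε t ⬝ᵥ ((gram Λ T1 b t)⁻¹ *ᵥ noiseSum T1 b ε t) ≤
      Real.log ((gram Λ T1 b t).det / (Λ.det * δ ^ 2))

/-- The self-normalized concentration inequality of Abbasi-Yadkori, Pál and Szepesvári, uniformly
over the steps `T1 ≤ t ≤ T`. -/
theorem measure_not_noiseConcentrated_le {Ω : Type*} {mΩ : MeasurableSpace Ω} {μ : Measure Ω}
    [IsProbabilityMeasure μ] {ℱ : Filtration ℕ mΩ} {Λ : Matrix ι ι ℝ} (hΛ : Λ.PosDef) {T1 T : ℕ}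
    (hT : T1 ≤ T) {b : ℕ → Ω → EuclideanSpace ℝ ι} {ε : ℕ → Ω → ℝ}
    (hb : ∀ t ∈ Finset.Ioc T1 T, Measurable[ℱ (t - 1)] (b t))
    (hε : ∀ t ∈ Finset.Ioc T1 T, Measurable[ℱ t] (ε t))
    (hind : ∀ t ∈ Finset.Ioc T1 T,
      Indep (MeasurableSpace.comap (ε t) inferInstance) (ℱ (t - 1)) μ)
    (hsub : ∀ t ∈ Finset.Ioc T1 T, HasSubgaussianMGF (ε t) 1 μ) {δ : ℝ} (hδ : 0 < δ) :
    μ {w | ¬ NoiseConcentrated Λ T1 T (fun τ => b τ w) (fun τ => ε τ w) δ} ≤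
      ENNReal.ofReal δ := by
  set V : ℕ → Ω → ι → ι → ℝ := fun t w => gram Λ T1 (fun τ => b τ w) t with hV
  set S : ℕ → Ω → ι → ℝ := fun t w => noiseSum T1 (fun τ => b τ w) (fun τ => ε τ w) t with hS
  have hVpos : ∀ t w, (Matrix.of (V t w)).PosDef := fun t w => gram_posDef hΛ _ _ _
  have hbm : ∀ t, t ≤ T → ∀ τ ∈ Finset.Ioc T1 t, Measurable[ℱ t] (b τ) := by
    intro t ht τ hτ
    rw [Finset.mem_Ioc] at hτ
    exact (hb τ (Finset.mem_Ioc.2 ⟨hτ.1, by omega⟩)).mono (ℱ.mono (by omega)) le_rfl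
  have hεm : ∀ t, t ≤ T → ∀ τ ∈ Finset.Ioc T1 t, Measurable[ℱ t] (ε τ) := by
    intro t ht τ hτ
    rw [Finset.mem_Ioc] at hτ
    exact (hε τ (Finset.mem_Ioc.2 ⟨hτ.1, by omega⟩)).mono (ℱ.mono (by omega)) le_rfl
  have hVm : ∀ t, t ≤ T → Measurable[ℱ t] (V t) := fun t ht =>
    measurable_gram Λ (hbm t ht)
  have hSm : ∀ t, t ≤ T → Measurable[ℱ t] (S t) := fun t ht =>
    measurable_noiseSum (hbm t ht) (hεm t ht)
  set Z : ℕ → Ω → ENNReal := fun t w =>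
    ENNReal.ofReal (gaussianMixture Λ (Matrix.of (V t w)) (S t w)) with hZ
  have hZm : ∀ t, T1 ≤ t → t ≤ T → Measurable[ℱ t] (Z t) := fun t _ ht =>
    ((measurable_gaussianMixture Λ).comp ((hVm t ht).prodMk (hSm t ht))).ennreal_ofReal
  have hstep : ∀ t, T1 ≤ t → t < T → ∀ F, MeasurableSet[ℱ t] F →
      ∫⁻ w in F, Z (t + 1) w ∂μ ≤ ∫⁻ w in F, Z t w ∂μ := by
    intro t h1 h2 F hF
    have hmem : t + 1 ∈ Finset.Ioc T1 T := Finset.mem_Ioc.2 ⟨by omega, by omega⟩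
    have hb' : Measurable[ℱ t] fun w => (b (t + 1) w).ofLp :=
      (WithLp.measurable_ofLp 2 (ι → ℝ)).comp (hb _ hmem)
    have h := setLIntegral_gaussianMixture_le (ℱ.le t) Λ (hVm t h2.le) (hSm t h2.le) hb' (hVpos t)
      ((hε _ hmem).mono (ℱ.le _) le_rfl) (hind _ hmem) (hsub _ hmem) hF
    refine le_trans (le_of_eq ?_) h
    refine lintegral_congr fun w => ?_
    simp only [hZ, hV, hS, gram_succ Λ _ h1, noiseSum_succ _ _ h1]
    rfl
  have hmax := measure_exists_le_of_supermartingale hT hZm hstep (ENNReal.ofReal δ⁻¹)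
  have hone : ∫⁻ w, Z T1 w ∂μ = 1 := by
    have : ∀ w, Z T1 w = 1 := by
      intro w
      have hd : Λ.det / Λ.det = 1 := div_self hΛ.det_pos.ne'
      simp only [hZ, hV, hS, gram_self, gaussianMixture, noiseSum]
      have : Matrix.of (Λ : ι → ι → ℝ) = Λ := rfl
      simp [this, hd]
    simp [this]
  rw [hone, ENNReal.ofReal_inv_of_pos hδ, mul_comm, ← div_eq_mul_inv,
    ENNReal.div_le_iff_le_mul (Or.inl (by simpa using hδ)) (Or.inl ENNReal.ofReal_ne_top),
    one_mul] at hmax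
  refine le_trans (measure_mono ?_) hmax
  intro w hw
  simp only [NoiseConcentrated, not_forall, not_le, Set.mem_ofPred_eq] at hw
  obtain ⟨t, h1, h2, h3⟩ := hw
  refine ⟨t, h1, h2, ?_⟩
  rw [← ENNReal.ofReal_inv_of_pos hδ]
  refine ENNReal.ofReal_le_ofReal ?_
  have hVd : 0 < (gram Λ T1 (fun τ => b τ w) t).det := (gram_posDef hΛ _ _ _).det_pos
  have hΛd := hΛ.det_pos
  rw [Real.log_lt_iff_lt_exp (by positivity)] at h3
  set Q := noiseSum T1 (fun τ => b τ w) (fun τ => ε τ w) t ⬝ᵥ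
            ((gram Λ T1 (fun τ => b τ w) t)⁻¹ *ᵥ
              noiseSum T1 (fun τ => b τ w) (fun τ => ε τ w) t) with hQ
  change δ⁻¹ ≤ √(Λ.det / (gram Λ T1 (fun τ => b τ w) t).det) * Real.exp (Q / 2)
  rw [Real.exp_half, ← Real.sqrt_mul (by positivity)]
  refine Real.le_sqrt_of_sq_le ?_
  calc δ⁻¹ ^ 2 = Λ.det / (gram Λ T1 (fun τ => b τ w) t).det *
        ((gram Λ T1 (fun τ => b τ w) t).det / (Λ.det * δ ^ 2)) := by field_simp
    _ ≤ _ := by gcongr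

end Gram

/-! ### Confidence ellipsoids and the elliptical potential -/

section QuadraticForm

variable {ι : Type*} [Fintype ι]

open scoped MatrixOrder Matrix.Norms.L2Operator in
lemma exists_dotProduct_mulVec_eq_inner {V : Matrix ι ι ℝ} (hV : V.PosSemidef) :
    ∃ R : Matrix ι ι ℝ, ∀ x y : ι → ℝ,
      x ⬝ᵥ (V *ᵥ y) = ⟪WithLp.toLp 2 (R *ᵥ x), WithLp.toLp 2 (R *ᵥ y)⟫ := by
  classical
  obtain ⟨R, rfl⟩ := CStarAlgebra.nonneg_iff_eq_star_mul_self.1 hV.nonneg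
  refine ⟨R, fun x y => ?_⟩
  rw [EuclideanSpace.inner_toLp_toLp, star_trivial (R *ᵥ x), ← Matrix.mulVec_mulVec,
    Matrix.dotProduct_mulVec, Matrix.star_eq_conjTranspose,
    Matrix.conjTranspose_eq_transpose_of_trivial, Matrix.vecMul_transpose, dotProduct_comm]

lemma abs_dotProduct_mulVec_le {V : Matrix ι ι ℝ} (hV : V.PosSemidef) (x y : ι → ℝ) :
    |x ⬝ᵥ (V *ᵥ y)| ≤ √(x ⬝ᵥ (V *ᵥ x)) * √(y ⬝ᵥ (V *ᵥ y)) := by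
  obtain ⟨R, hR⟩ := exists_dotProduct_mulVec_eq_inner hV
  rw [hR, hR, hR, ← norm_eq_sqrt_real_inner, ← norm_eq_sqrt_real_inner]
  exact abs_real_inner_le_norm _ _

lemma sqrt_quadForm_sub_le {V : Matrix ι ι ℝ} (hV : V.PosSemidef) (x y : ι → ℝ) :
    √((x - y) ⬝ᵥ (V *ᵥ (x - y))) ≤ √(x ⬝ᵥ (V *ᵥ x)) + √(y ⬝ᵥ (V *ᵥ y)) := by
  obtain ⟨R, hR⟩ := exists_dotProduct_mulVec_eq_inner hV
  rw [hR, hR, hR, ← norm_eq_sqrt_real_inner, ← norm_eq_sqrt_real_inner, ← norm_eq_sqrt_real_inner,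
    Matrix.mulVec_sub, WithLp.toLp_sub]
  exact norm_sub_le _ _

variable [DecidableEq ι]

lemma quadForm_inv_mulVec {V : Matrix ι ι ℝ} (hV : V.PosDef) (x : ι → ℝ) :
    (V⁻¹ *ᵥ x) ⬝ᵥ (V *ᵥ (V⁻¹ *ᵥ x)) = x ⬝ᵥ (V⁻¹ *ᵥ x) := by
  rw [Matrix.mulVec_mulVec, Matrix.mul_nonsing_inv _ hV.det_pos.ne'.isUnit, Matrix.one_mulVec,
    dotProduct_comm]

lemma abs_dotProduct_le_sqrt_inv {V : Matrix ι ι ℝ} (hV : V.PosDef) (x y : ι → ℝ) :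
    |x ⬝ᵥ y| ≤ √(x ⬝ᵥ (V⁻¹ *ᵥ x)) * √(y ⬝ᵥ (V *ᵥ y)) := by
  have h := abs_dotProduct_mulVec_le hV.posSemidef (V⁻¹ *ᵥ x) y
  rwa [quadForm_inv_mulVec hV, dotProduct_mulVec_symm hV.isHermitian, Matrix.mulVec_mulVec,
    Matrix.mul_nonsing_inv _ hV.det_pos.ne'.isUnit, Matrix.one_mulVec, dotProduct_comm y] at h

/-- `‖Λ y‖_{V⁻¹} ≤ ‖y‖_Λ` when `Λ ≤ V`. -/
lemma sqrt_quadForm_inv_mulVec_le {V Λ : Matrix ι ι ℝ} (hV : V.PosDef) (hΛ : Λ.PosDef)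
    (h : (V - Λ).PosSemidef) (y : ι → ℝ) :
    √((Λ *ᵥ y) ⬝ᵥ (V⁻¹ *ᵥ (Λ *ᵥ y))) ≤ √(y ⬝ᵥ (Λ *ᵥ y)) := by
  set z := V⁻¹ *ᵥ (Λ *ᵥ y) with hz
  set s := (Λ *ᵥ y) ⬝ᵥ z with hs
  have hs0 : 0 ≤ s := by
    have h := hV.inv.posSemidef.dotProduct_mulVec_nonneg (Λ *ᵥ y)
    rwa [star_trivial] at h
  have h1 : s ≤ √(z ⬝ᵥ (Λ *ᵥ z)) * √(y ⬝ᵥ (Λ *ᵥ y)) := by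
    rw [hs, dotProduct_comm]
    exact (le_abs_self _).trans (abs_dotProduct_mulVec_le hΛ.posSemidef z y)
  have h2 : z ⬝ᵥ (Λ *ᵥ z) ≤ s := by
    have h3 : 0 ≤ z ⬝ᵥ ((V - Λ) *ᵥ z) := by simpa using h.dotProduct_mulVec_nonneg z
    rw [Matrix.sub_mulVec, dotProduct_sub, hz, quadForm_inv_mulVec hV] at h3
    linarith
  have h3 : √s * √s ≤ √s * √(y ⬝ᵥ (Λ *ᵥ y)) := by
    rw [Real.mul_self_sqrt hs0]
    exact h1.trans (mul_le_mul_of_nonneg_right (Real.sqrt_le_sqrt h2) (Real.sqrt_nonneg _))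
  rcases (Real.sqrt_nonneg s).eq_or_lt with h4 | h4
  · rw [← h4]
    positivity
  · exact le_of_mul_le_mul_left h3 h4

end QuadraticForm

section Confidence

variable {ι : Type*}

lemma designMatrix_transpose_mulVec (T1 : ℕ) (b : ℕ → EuclideanSpace ℝ ι) (f : ℕ → ℝ) (t : ℕ) :
    ((designMatrix T1 b t)ᵀ *ᵥ fun τ => f τ) = ∑ τ ∈ Finset.Ioc T1 t, f τ • (b τ).ofLp := by
  ext i
  rw [Finset.sum_apply, Matrix.mulVec, dotProduct,
    ← Finset.sum_coe_sort (Finset.Ioc T1 t) fun τ => (f τ • (b τ).ofLp) i]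
  refine Finset.sum_congr rfl fun τ _ => ?_
  rw [Pi.smul_apply, smul_eq_mul, mul_comm]
  rfl

variable [Fintype ι]

lemma gram_mulVec (Λ : Matrix ι ι ℝ) (T1 : ℕ) (b : ℕ → EuclideanSpace ℝ ι) (t : ℕ)
    (y : EuclideanSpace ℝ ι) :
    gram Λ T1 b t *ᵥ y.ofLp =
      Λ *ᵥ y.ofLp + ∑ τ ∈ Finset.Ioc T1 t, ⟪b τ, y⟫ • (b τ).ofLp := by
  rw [gram, Matrix.add_mulVec, ← Matrix.mulVec_mulVec, ← designMatrix_transpose_mulVec]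
  congr 2
  ext τ
  rw [PiLp.inner_apply]
  simp only [Matrix.mulVec, dotProduct, designMatrix, Matrix.of_apply]
  refine Finset.sum_congr rfl fun i _ => ?_
  simp [mul_comm]

variable [DecidableEq ι]

lemma sub_ridge_eq {Λ : Matrix ι ι ℝ} (hΛ : Λ.PosDef) {T1 t : ℕ} {b : ℕ → EuclideanSpace ℝ ι}
    {rew ε : ℕ → ℝ} {y : EuclideanSpace ℝ ι}
    (hrew : ∀ τ ∈ Finset.Ioc T1 t, rew τ = ⟪b τ, y⟫ + ε τ) :
    y.ofLp - ridge Λ T1 b rew t =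
      (gram Λ T1 b t)⁻¹ *ᵥ (Λ *ᵥ y.ofLp) - (gram Λ T1 b t)⁻¹ *ᵥ noiseSum T1 b ε t := by
  have hV := gram_posDef hΛ T1 b t
  have h1 : y.ofLp = (gram Λ T1 b t)⁻¹ *ᵥ (gram Λ T1 b t *ᵥ y.ofLp) := by
    rw [Matrix.mulVec_mulVec, Matrix.nonsing_inv_mul _ hV.det_pos.ne'.isUnit, Matrix.one_mulVec]
  have h2 : ∑ τ ∈ Finset.Ioc T1 t, rew τ • (b τ).ofLp =
      ∑ τ ∈ Finset.Ioc T1 t, ⟪b τ, y⟫ • (b τ).ofLp + noiseSum T1 b ε t := by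
    rw [noiseSum, ← Finset.sum_add_distrib]
    exact Finset.sum_congr rfl fun τ hτ => by rw [hrew τ hτ, add_smul]
  nth_rewrite 1 [h1]
  rw [ridge, designMatrix_transpose_mulVec, gram_mulVec, ← Matrix.mulVec_sub, ← Matrix.mulVec_sub,
    h2]
  congr 1
  abel

/-- On the event of the self-normalized concentration inequality, the confidence set contains the
true parameter. -/
lemma mem_confSet {Λ : Matrix ι ι ℝ} (hΛ : Λ.PosDef) {T1 t : ℕ} {b : ℕ → EuclideanSpace ℝ ι}
    {rew ε : ℕ → ℝ} {y : EuclideanSpace ℝ ι} {δ l lp C Cp : ℝ}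
    (hrew : ∀ τ ∈ Finset.Ioc T1 t, rew τ = ⟪b τ, y⟫ + ε τ) (ht : T1 < t)
    (hy : √(y.ofLp ⬝ᵥ (Λ *ᵥ y.ofLp)) ≤ √l * C + √lp * Cp)
    (hS : noiseSum T1 b ε t ⬝ᵥ ((gram Λ T1 b t)⁻¹ *ᵥ noiseSum T1 b ε t) ≤
      Real.log ((gram Λ T1 b t).det / (Λ.det * δ ^ 2))) :
    y ∈ confSet Λ T1 b rew δ l lp C Cp t := by
  have hV := gram_posDef hΛ T1 b t
  rw [confSet, if_neg (by omega), Set.mem_ofPred_eq, sub_ridge_eq hΛ hrew, sqrtBeta]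
  refine (sqrt_quadForm_sub_le hV.posSemidef _ _).trans ?_
  rw [quadForm_inv_mulVec hV, quadForm_inv_mulVec hV]
  have h1 : (gram Λ T1 b t - Λ).PosSemidef := by
    have h := Matrix.posSemidef_conjTranspose_mul_self (designMatrix T1 b t)
    rwa [Matrix.conjTranspose_eq_transpose_of_trivial, ← add_sub_cancel_left Λ (_ * _)] at h
  have h2 := (sqrt_quadForm_inv_mulVec_le hV hΛ h1 y.ofLp).trans hy
  have h3 := Real.sqrt_le_sqrt hS
  linarith

lemma inner_le_of_mem_confSet {Λ : Matrix ι ι ℝ} (hΛ : Λ.PosDef) {T1 t : ℕ}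
    {b : ℕ → EuclideanSpace ℝ ι} {rew : ℕ → ℝ} {y z : EuclideanSpace ℝ ι} {δ l lp C Cp : ℝ}
    (ht : T1 < t) (hy : y ∈ confSet Λ T1 b rew δ l lp C Cp t)
    (hz : z ∈ confSet Λ T1 b rew δ l lp C Cp t) (x : EuclideanSpace ℝ ι) :
    ⟪x, z⟫ ≤ ⟪x, y⟫ +
      2 * sqrtBeta Λ T1 b δ l lp C Cp t * √(x.ofLp ⬝ᵥ ((gram Λ T1 b t)⁻¹ *ᵥ x.ofLp)) := by
  have hV := gram_posDef hΛ T1 b t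
  rw [confSet, if_neg (by omega), Set.mem_ofPred_eq] at hy hz
  have h1 := (abs_dotProduct_le_sqrt_inv hV x.ofLp _).trans
    (mul_le_mul_of_nonneg_left hy (Real.sqrt_nonneg _))
  have h2 := (abs_dotProduct_le_sqrt_inv hV x.ofLp _).trans
    (mul_le_mul_of_nonneg_left hz (Real.sqrt_nonneg _))
  have h3 : ∀ v : EuclideanSpace ℝ ι, ⟪x, v⟫ = x.ofLp ⬝ᵥ v.ofLp := fun v => by
    rw [EuclideanSpace.inner_eq_star_dotProduct, star_trivial, dotProduct_comm]
  rw [dotProduct_sub] at h1 h2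
  rw [h3, h3]
  have h4 := (abs_le.1 h1).1
  have h5 := (abs_le.1 h2).2
  linarith

/-- The regret of one optimistic step. If `a` maximizes the optimistic value among the candidates
`x`, then its regret for the true parameter `y` is at most twice the confidence width at `a`. -/
lemma inner_le_of_optimisticValue_le {Λ : Matrix ι ι ℝ} (hΛ : Λ.PosDef) {T1 t : ℕ}
    {b : ℕ → EuclideanSpace ℝ ι} {rew : ℕ → ℝ} {y x a : EuclideanSpace ℝ ι} {δ l lp C Cp : ℝ}
    (ht : T1 < t) (hy : y ∈ confSet Λ T1 b rew δ l lp C Cp t)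
    (hopt : optimisticValue (confSet Λ T1 b rew δ l lp C Cp t) x ≤
      optimisticValue (confSet Λ T1 b rew δ l lp C Cp t) a) :
    ⟪x, y⟫ ≤ ⟪a, y⟫ +
      2 * sqrtBeta Λ T1 b δ l lp C Cp t * √(a.ofLp ⬝ᵥ ((gram Λ T1 b t)⁻¹ *ᵥ a.ofLp)) := by
  have h1 : ⟪x, y⟫ ≤ optimisticValue (confSet Λ T1 b rew δ l lp C Cp t) x := by
    refine le_csSup ?_ (Set.mem_image_of_mem _ hy)
    refine ⟨⟪x, y⟫ +
      2 * sqrtBeta Λ T1 b δ l lp C Cp t * √(x.ofLp ⬝ᵥ ((gram Λ T1 b t)⁻¹ *ᵥ x.ofLp)), ?_⟩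
    rintro _ ⟨z, hz, rfl⟩
    exact inner_le_of_mem_confSet hΛ ht hy hz x
  refine h1.trans (hopt.trans (csSup_le ⟨_, Set.mem_image_of_mem _ hy⟩ ?_))
  rintro _ ⟨z, hz, rfl⟩
  exact inner_le_of_mem_confSet hΛ ht hy hz a

end Confidence

section Potential

variable {ι : Type*} [Fintype ι] [DecidableEq ι]

/-- The elliptical potential identity. -/
lemma sum_log_one_add_quadForm {Λ : Matrix ι ι ℝ} (hΛ : Λ.PosDef) {T1 T : ℕ} (hT : T1 ≤ T)
    (b : ℕ → EuclideanSpace ℝ ι) :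
    ∑ t ∈ Finset.Ioc T1 T,
        Real.log (1 + (b t).ofLp ⬝ᵥ ((gram Λ T1 b (t - 1))⁻¹ *ᵥ (b t).ofLp)) =
      Real.log ((gram Λ T1 b T).det / Λ.det) := by
  induction T, hT using Nat.le_induction with
  | base => simp [gram_self, hΛ.det_pos.ne']
  | succ t ht ih =>
    have hV := gram_posDef hΛ T1 b t
    have hu : 0 ≤ (b (t + 1)).ofLp ⬝ᵥ ((gram Λ T1 b t)⁻¹ *ᵥ (b (t + 1)).ofLp) := by
      simpa using hV.inv.posSemidef.dotProduct_mulVec_nonneg (b (t + 1)).ofLp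
    rw [← Finset.insert_Ioc_right_eq_Ioc_add_one ht, Finset.sum_insert (by simp), ih,
      gram_succ Λ b ht, det_add_vecMulVec hV.det_pos.ne'.isUnit, Nat.add_sub_cancel,
      ← Real.log_mul (by positivity) (div_pos hV.det_pos hΛ.det_pos).ne']
    congr 1
    ring

/-- Only the coordinates with the small regularizer `l` contribute to the log-determinant
individually; all the others together contribute at most `T / lp`. -/
lemma log_det_gram_div_le {p : ι → Prop} [DecidablePred p] {l lp : ℝ} (hl : 0 < l) (hlp : 0 < lp)
    {T1 t T : ℕ} (htT : t ≤ T) {b : ℕ → EuclideanSpace ℝ ι}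
    (hb : ∀ τ ∈ Finset.Ioc T1 t, ‖b τ‖ ≤ 1) :
    Real.log ((gram (Matrix.diagonal fun i => if p i then l else lp) T1 b t).det /
        (Matrix.diagonal fun i => if p i then l else lp).det) ≤
      (Finset.univ.filter p).card * Real.log (1 + T / l) + T / lp := by
  set L : ι → ℝ := fun i => if p i then l else lp with hL
  have hLpos : ∀ i, 0 < L i := fun i => by simp only [hL]; split_ifs <;> assumption
  have hΛ : (Matrix.diagonal L).PosDef := Matrix.PosDef.diagonal hLpos
  have hV := gram_posDef hΛ T1 b t
  -- `D` majorizes the diagonal of the Gram matrix only where `p` holds; the excess elsewhere enters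
  -- the exponential through the trace.
  set D : ι → ℝ := fun i => if p i then l + T else lp with hD
  have hDpos : ∀ i, 0 < D i := fun i => by simp only [hD]; split_ifs <;> positivity
  have hnorm : ∀ τ ∈ Finset.Ioc T1 t, ∑ i, b τ i * b τ i ≤ 1 := by
    intro τ hτ
    have h1 : ‖b τ‖ ^ 2 ≤ 1 := pow_le_one₀ (norm_nonneg _) (hb τ hτ)
    rw [EuclideanSpace.norm_sq_eq] at h1
    simpa [sq_abs, sq] using h1
  have hcard : ((Finset.Ioc T1 t).card : ℝ) ≤ T := by
    rw [Nat.card_Ioc]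
    exact_mod_cast (Nat.sub_le _ _).trans htT
  have hcoord : ∀ i, ∑ τ ∈ Finset.Ioc T1 t, b τ i * b τ i ≤ T := by
    intro i
    calc ∑ τ ∈ Finset.Ioc T1 t, b τ i * b τ i ≤ ∑ τ ∈ Finset.Ioc T1 t, (1 : ℝ) :=
          Finset.sum_le_sum fun τ hτ => (Finset.single_le_sum (f := fun i => b τ i * b τ i)
            (fun j _ => mul_self_nonneg _) (Finset.mem_univ i)).trans (hnorm τ hτ)
      _ ≤ T := by simpa using hcard
  have hexp : ∑ i, (gram (Matrix.diagonal L) T1 b t i i / D i - 1) ≤ T / lp := by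
    calc ∑ i, (gram (Matrix.diagonal L) T1 b t i i / D i - 1)
        ≤ ∑ i, (∑ τ ∈ Finset.Ioc T1 t, b τ i * b τ i) / lp := by
          refine Finset.sum_le_sum fun i _ => ?_
          have h0 : 0 ≤ ∑ τ ∈ Finset.Ioc T1 t, b τ i * b τ i :=
            Finset.sum_nonneg fun τ _ => mul_self_nonneg _
          rw [gram_apply, Matrix.diagonal_apply_eq]
          by_cases hp : p i
          · have h1 : (L i + ∑ τ ∈ Finset.Ioc T1 t, b τ i * b τ i) / D i ≤ 1 := by
              rw [div_le_one (hDpos i)]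
              simp only [hL, hD, if_pos hp]
              linarith [hcoord i]
            have h2 : 0 ≤ (∑ τ ∈ Finset.Ioc T1 t, b τ i * b τ i) / lp := by positivity
            linarith
          · simp only [hL, hD, if_neg hp]
            rw [add_div, div_self hlp.ne']
            linarith
      _ = (∑ τ ∈ Finset.Ioc T1 t, ∑ i, b τ i * b τ i) / lp := by
          rw [← Finset.sum_div, Finset.sum_comm]
      _ ≤ T / lp := by
          gcongr
          calc ∑ τ ∈ Finset.Ioc T1 t, ∑ i, b τ i * b τ i ≤ ∑ τ ∈ Finset.Ioc T1 t, (1 : ℝ) :=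
                Finset.sum_le_sum hnorm
            _ ≤ T := by simpa using hcard
  have hdet := det_le_prod_mul_exp hV D hDpos
  have hratio : (∏ i, D i) / (Matrix.diagonal L).det =
      (1 + T / l) ^ (Finset.univ.filter p).card := by
    rw [Matrix.det_diagonal, ← Finset.prod_div_distrib, ← Finset.prod_const, Finset.prod_filter]
    refine Finset.prod_congr rfl fun i _ => ?_
    by_cases hp : p i
    · simp only [hL, hD, if_pos hp]
      rw [add_div, div_self hl.ne']
    · simp only [hL, hD, if_neg hp]
      exact div_self hlp.ne'
  have h1 : (gram (Matrix.diagonal L) T1 b t).det / (Matrix.diagonal L).det ≤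
      (1 + T / l) ^ (Finset.univ.filter p).card * Real.exp (T / lp) := by
    rw [← hratio, div_mul_eq_mul_div]
    have := hΛ.det_pos
    gcongr
    refine hdet.trans (mul_le_mul_of_nonneg_left (Real.exp_le_exp.2 hexp) ?_)
    exact Finset.prod_nonneg fun i _ => (hDpos i).le
  calc Real.log ((gram (Matrix.diagonal L) T1 b t).det / (Matrix.diagonal L).det)
      ≤ Real.log ((1 + T / l) ^ (Finset.univ.filter p).card * Real.exp (T / lp)) :=
        Real.log_le_log (div_pos hV.det_pos hΛ.det_pos) h1
    _ = _ := by
        rw [Real.log_mul (by positivity) (Real.exp_pos _).ne', Real.log_exp, Real.log_pow]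

/-- Summing the regret of the optimistic steps. The steps of large width `u t ≥ 1` are few, because
each of them adds a constant to the potential `∑ log (1 + u t) ≤ D`; the others are summed by the
Cauchy–Schwarz inequality. The width bound is not available at the step `T1 + 1`. -/
lemma sum_le_of_le_min {T1 T : ℕ} {reg u : ℕ → ℝ} {C β D : ℝ} (hC : 0 ≤ C) (hβ : 0 ≤ β)
    (hu : ∀ t, 0 ≤ u t) (h1 : ∀ t ∈ Finset.Ioc T1 T, reg t ≤ 2 * C)
    (h2 : ∀ t ∈ Finset.Ioc (T1 + 1) T, reg t ≤ 2 * β * √(u t))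
    (hD : ∑ t ∈ Finset.Ioc T1 T, Real.log (1 + u t) ≤ D) :
    ∑ t ∈ Finset.Ioc T1 T, reg t ≤ 2 * C + 4 * C * D + 3 * β * √(T * D) := by
  have hx : ∀ t, 0 ≤ Real.log (1 + u t) := fun t => Real.log_nonneg (by linarith [hu t])
  have hstep : ∀ t ∈ Finset.Ioc T1 T, reg t ≤
      (if t = T1 + 1 then 2 * C else 0) + (4 * C * Real.log (1 + u t) +
        3 * β * √(Real.log (1 + u t))) := by
    intro t ht
    have h0 : 0 ≤ 4 * C * Real.log (1 + u t) + 3 * β * √(Real.log (1 + u t)) := by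
      have := hx t
      positivity
    split_ifs with hts
    · linarith [h1 t ht]
    rw [zero_add]
    have hlow : 1 - (1 + u t)⁻¹ ≤ Real.log (1 + u t) :=
      Real.one_sub_inv_le_log_of_pos (by linarith [hu t])
    rcases le_total 1 (u t) with h | h
    · have h3 : (1 + u t)⁻¹ ≤ 1 / 2 := by
        rw [inv_le_comm₀ (by linarith) (by norm_num)]
        norm_num
        linarith
      have h4 : 2 * C ≤ 4 * C * Real.log (1 + u t) := by nlinarith
      have h5 : 0 ≤ 3 * β * √(Real.log (1 + u t)) := by positivity
      linarith [h1 t ht]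
    · have h3 : u t ≤ 2 * Real.log (1 + u t) := by
        have h4 : u t / 2 ≤ 1 - (1 + u t)⁻¹ := by
          have h6 : 1 - (1 + u t)⁻¹ = u t / (1 + u t) := by
            have : 1 + u t ≠ 0 := by linarith [hu t]
            field_simp
            ring
          rw [h6]
          exact div_le_div_of_nonneg_left (hu t) (by linarith [hu t]) (by linarith)
        linarith
      have h4 : √(u t) ≤ 3 / 2 * √(Real.log (1 + u t)) := by
        rw [Real.sqrt_le_left (by positivity), mul_pow, Real.sq_sqrt (hx t)]
        linarith [hx t]
      have h5 : 0 ≤ 4 * C * Real.log (1 + u t) := by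
        have := hx t
        positivity
      have hmem : t ∈ Finset.Ioc (T1 + 1) T := by
        rw [Finset.mem_Ioc] at ht ⊢
        omega
      have h6 := mul_le_mul_of_nonneg_left h4 (by positivity : 0 ≤ 2 * β)
      linarith [h2 t hmem]
  have hD0 : 0 ≤ D := (Finset.sum_nonneg fun t _ => hx t).trans hD
  have hsqrt : ∑ t ∈ Finset.Ioc T1 T, √(Real.log (1 + u t)) ≤ √(T * D) := by
    refine Real.le_sqrt_of_sq_le (sq_sum_le_card_mul_sum_sq.trans ?_)
    have hcard : ((Finset.Ioc T1 T).card : ℝ) ≤ T := by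
      rw [Nat.card_Ioc]
      exact_mod_cast Nat.sub_le _ _
    refine mul_le_mul hcard ?_ (Finset.sum_nonneg fun t _ => sq_nonneg _) (Nat.cast_nonneg _)
    refine le_trans (le_of_eq ?_) hD
    exact Finset.sum_congr rfl fun t _ => Real.sq_sqrt (hx t)
  calc ∑ t ∈ Finset.Ioc T1 T, reg t
      ≤ ∑ t ∈ Finset.Ioc T1 T, ((if t = T1 + 1 then 2 * C else 0) +
          (4 * C * Real.log (1 + u t) + 3 * β * √(Real.log (1 + u t)))) := Finset.sum_le_sum hstep
    _ = (∑ t ∈ Finset.Ioc T1 T, if t = T1 + 1 then 2 * C else 0) +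
          (4 * C * ∑ t ∈ Finset.Ioc T1 T, Real.log (1 + u t) +
            3 * β * ∑ t ∈ Finset.Ioc T1 T, √(Real.log (1 + u t))) := by
        rw [Finset.sum_add_distrib, Finset.sum_add_distrib, Finset.mul_sum, Finset.mul_sum]
    _ ≤ 2 * C + (4 * C * D + 3 * β * √(T * D)) := by
        gcongr
        rw [Finset.sum_ite_eq']
        split_ifs <;> linarith
    _ = _ := by ring

end Potential

/-! ### Multi-mode products, unfoldings and singular values -/

section MultiMode

variable {N : ℕ} {ι κ μ : Type*} [Fintype ι] [Fintype κ] [Fintype μ]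

lemma multiModeProd_apply (Y : Tensor N κ) (B : Fin N → Matrix ι κ ℝ) (i : Fin N → ι) :
    multiModeProd Y B i = ∑ j : Fin N → κ, (∏ n, B n (i n) (j n)) * Y j := rfl

lemma multiModeProd_multiModeProd (Y : Tensor N κ) (B : Fin N → Matrix ι κ ℝ)
    (B' : Fin N → Matrix μ ι ℝ) :
    multiModeProd (multiModeProd Y B) B' = multiModeProd Y fun n => B' n * B n := by
  classical
  ext i
  simp only [multiModeProd_apply, Matrix.mul_apply, Finset.prod_univ_sum, Fintype.piFinset_univ,
    Finset.mul_sum, Finset.sum_mul, Finset.prod_mul_distrib]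
  rw [Finset.sum_comm]
  simp only [mul_assoc]

lemma multiModeProd_one [DecidableEq κ] (Y : Tensor N κ) :
    (multiModeProd Y fun _ => (1 : Matrix κ κ ℝ)) = Y := by
  ext i
  rw [multiModeProd_apply, Finset.sum_eq_single i]
  · simp
  · intro j _ hj
    obtain ⟨n, hn⟩ := Function.ne_iff.1 hj
    have h0 : (1 : Matrix κ κ ℝ) (i n) (j n) = 0 := Matrix.one_apply_ne hn.symm
    exact mul_eq_zero_of_left (Finset.prod_eq_zero (Finset.mem_univ n) h0) _
  · simp

lemma inner_multiModeProd_left (Y : Tensor N κ) (B : Fin N → Matrix ι κ ℝ) (Z : Tensor N ι) :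
    ⟪multiModeProd Y B, Z⟫ = ⟪Y, multiModeProd Z fun n => (B n)ᵀ⟫ := by
  simp only [PiLp.inner_apply, multiModeProd_apply, RCLike.inner_apply, conj_trivial,
    Finset.mul_sum, Finset.sum_mul, Matrix.transpose_apply]
  rw [Finset.sum_comm]
  refine Finset.sum_congr rfl fun j _ => Finset.sum_congr rfl fun i _ => ?_
  ring

lemma inner_multiModeProd_of_isometry [DecidableEq κ] {B : Fin N → Matrix ι κ ℝ}
    (hB : ∀ n, (B n)ᵀ * B n = 1) (Y Z : Tensor N κ) :
    ⟪multiModeProd Y B, multiModeProd Z B⟫ = ⟪Y, Z⟫ := by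
  rw [inner_multiModeProd_left, multiModeProd_multiModeProd]
  simp only [hB, multiModeProd_one]

/-- The mode-`n` matricization of a tensor with an arbitrary index type. -/
def unfolding (n : Fin N) (Y : Tensor N κ) : Matrix κ ({m : Fin N // m ≠ n} → κ) ℝ :=
  Matrix.of fun a j => Y ((Equiv.funSplitAt n κ).symm (a, j))

lemma matricize_eq_unfolding {d : ℕ} (n : Fin N) (Y : Tensor N (Fin d)) :
    matricize n Y = unfolding n Y := by
  ext a j
  simp only [matricize, unfolding, Matrix.of_apply]
  refine congrArg (fun f => Y f) (funext fun m => ?_)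
  simp [Equiv.funSplitAt_symm_apply]

/-- The matrix by which a multi-mode product acts on the columns of the mode-`n` unfolding: the
Kronecker product of the factors of all the other modes. -/
def offModeKronecker (n : Fin N) (B : Fin N → Matrix ι κ ℝ) :
    Matrix ({m : Fin N // m ≠ n} → ι) ({m : Fin N // m ≠ n} → κ) ℝ :=
  Matrix.of fun j k => ∏ l : {m : Fin N // m ≠ n}, B l (j l) (k l)

lemma unfolding_multiModeProd (n : Fin N) (Y : Tensor N κ) (B : Fin N → Matrix ι κ ℝ) :
    unfolding n (multiModeProd Y B) =
      B n * (unfolding n Y * (offModeKronecker n B)ᵀ) := by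
  ext a j
  simp only [unfolding, offModeKronecker, Matrix.of_apply, multiModeProd_apply, Matrix.mul_apply,
    Matrix.transpose_apply, Finset.mul_sum]
  rw [← (Equiv.funSplitAt n κ).symm.sum_comp, Fintype.sum_prod_type]
  refine Finset.sum_congr rfl fun c _ => Finset.sum_congr rfl fun k _ => ?_
  have h : (∏ m, B m ((Equiv.funSplitAt n ι).symm (a, j) m) ((Equiv.funSplitAt n κ).symm (c, k) m))
      = B n a c * ∏ l : {m : Fin N // m ≠ n}, B l (j l) (k l) := by
    rw [Fintype.prod_eq_mul_prod_subtype_ne _ n]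
    congr 1
    · simp [Equiv.funSplitAt_symm_apply]
    · refine Finset.prod_congr rfl fun l _ => ?_
      simp [Equiv.funSplitAt_symm_apply, l.2]
  rw [h]
  ring

lemma norm_sq_eq_sum_unfolding (n : Fin N) (Y : Tensor N κ) :
    ‖Y‖ ^ 2 = ∑ j, (unfolding n Y).col j ⬝ᵥ (unfolding n Y).col j := by
  rw [EuclideanSpace.norm_sq_eq, ← (Equiv.funSplitAt n κ).symm.sum_comp, Fintype.sum_prod_type,
    Finset.sum_comm]
  refine Finset.sum_congr rfl fun j _ => Finset.sum_congr rfl fun a _ => ?_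
  rw [Real.norm_eq_abs, sq_abs, sq]
  rfl

/-- Replacing the factor of one mode scales the norm by at most the relative operator norm of the
new factor on the mode-`n` column space. -/
lemma norm_multiModeProd_le_of_eq_off {n : Fin N} {X : Tensor N κ}
    {B B' : Fin N → Matrix ι κ ℝ} (hoff : ∀ m, m ≠ n → B' m = B m) {c : ℝ} (hc : 0 ≤ c)
    (h : ∀ z, (B' n *ᵥ (unfolding n X *ᵥ z)) ⬝ᵥ (B' n *ᵥ (unfolding n X *ᵥ z)) ≤
      c ^ 2 * ((B n *ᵥ (unfolding n X *ᵥ z)) ⬝ᵥ (B n *ᵥ (unfolding n X *ᵥ z)))) :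
    ‖multiModeProd X B'‖ ≤ c * ‖multiModeProd X B‖ := by
  refine le_of_sq_le_sq ?_ (by positivity)
  rw [mul_pow, norm_sq_eq_sum_unfolding n, norm_sq_eq_sum_unfolding n, Finset.mul_sum]
  refine Finset.sum_le_sum fun j _ => ?_
  have hK : offModeKronecker n B' = offModeKronecker n B := by
    ext j k
    simp only [offModeKronecker, Matrix.of_apply]
    exact Finset.prod_congr rfl fun l _ => by rw [hoff l.1 l.2]
  rw [unfolding_multiModeProd, unfolding_multiModeProd, hK]
  exact h _

end MultiMode

section SingularValue

/-- Every vector in the range of `M` has a preimage whose norm is controlled by the smallest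
positive singular value. -/
lemma exists_mulVec_eq_of_le_minPosSingularValue {m n : Type*} [Fintype m] [Fintype n]
    [DecidableEq n] {M : Matrix m n ℝ} {ω : ℝ} (hω : 0 < ω) (h : ω ≤ minPosSingularValue M)
    (z : n → ℝ) :
    ∃ z', M *ᵥ z' = M *ᵥ z ∧ ω ^ 2 * (z' ⬝ᵥ z') ≤ (M *ᵥ z) ⬝ᵥ (M *ᵥ z) := by
  classical
  set L := Matrix.toEuclideanLin M with hL
  have hsymm := L.isSymmetric_adjoint_comp_self
  set v := hsymm.eigenvectorBasis rfl with hv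
  set ev := hsymm.eigenvalues rfl with hev
  have hnorm : ∀ x, ‖L x‖ ^ 2 = ∑ i, ev i * (v.repr x i) ^ 2 := by
    intro x
    have h1 : ‖L x‖ ^ 2 = ⟪(LinearMap.adjoint L ∘ₗ L) x, x⟫ := by
      rw [LinearMap.comp_apply, LinearMap.adjoint_inner_left, real_inner_self_eq_norm_sq]
    rw [h1, ← v.repr.inner_map_map, PiLp.inner_apply]
    refine Finset.sum_congr rfl fun i _ => ?_
    rw [hv, hsymm.eigenvectorBasis_apply_self_apply]
    simp only [RCLike.inner_apply, conj_trivial, RCLike.ofReal_real_eq_id, id_eq]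
    ring
  have hlow : ∀ i, ev i ≠ 0 → ω ^ 2 ≤ ev i := by
    intro i hi
    have hs : L.singularValues i ^ 2 = ev i := L.sq_singularValues_fin rfl i
    have hpos : 0 < L.singularValues i := by
      refine lt_of_le_of_ne (L.singularValues_nonneg _) fun h0 => hi ?_
      rw [← hs, ← h0]
      simp
    have hle : ω ≤ L.singularValues i :=
      h.trans (csInf_le ⟨0, fun s hs => hs.1.le⟩ ⟨hpos, i, rfl⟩)
    rw [← hs]
    exact pow_le_pow_left₀ hω.le hle 2
  set x := WithLp.toLp 2 z with hx
  -- `x'` is `x` without its components in the kernel.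
  set x' := v.repr.symm (WithLp.toLp 2 fun i => if ev i = 0 then 0 else v.repr x i) with hx'
  have hrepr : ∀ i, v.repr x' i = if ev i = 0 then 0 else v.repr x i := by
    intro i
    rw [hx', LinearIsometryEquiv.apply_symm_apply]
  have heq : L x' = L x := by
    rw [← sub_eq_zero, ← map_sub, ← norm_eq_zero, ← sq_eq_zero_iff, hnorm]
    refine Finset.sum_eq_zero fun i _ => ?_
    rw [map_sub, PiLp.sub_apply, hrepr]
    by_cases hi : ev i = 0 <;> simp [hi]
  have hbound : ω ^ 2 * ‖x'‖ ^ 2 ≤ ‖L x'‖ ^ 2 := by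
    rw [hnorm, ← v.repr.norm_map, EuclideanSpace.norm_sq_eq, Finset.mul_sum]
    refine Finset.sum_le_sum fun i _ => ?_
    rw [Real.norm_eq_abs, sq_abs, hrepr]
    by_cases hi : ev i = 0
    · simp [hi]
    · exact mul_le_mul_of_nonneg_right (hlow i hi) (sq_nonneg _)
  have hdot : ∀ {k : Type _} [Fintype k] (y : EuclideanSpace ℝ k), ‖y‖ ^ 2 = y.ofLp ⬝ᵥ y.ofLp := by
    intro k _ y
    rw [EuclideanSpace.norm_sq_eq]
    simp [dotProduct, sq]
  refine ⟨x'.ofLp, ?_, ?_⟩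
  · exact congrArg WithLp.ofLp heq
  · rw [heq, hdot] at hbound
    refine hbound.trans_eq ?_
    rw [EuclideanSpace.norm_sq_eq]
    simp [dotProduct, sq, hL, hx, Matrix.toLpLin_apply]

end SingularValue

/-! ### Projected tensors and their tails -/

section Counting

variable {N d r : ℕ}

/-- The set of modes in which an index of a projected tensor lies in the tail. -/
def tailModes (i : Fin N → Mode d r) : Finset (Fin N) :=
  Finset.univ.filter fun n => (i n).isRight = true

lemma card_tailModes (i : Fin N → Mode d r) : (tailModes i).card = tails i := rfl

lemma card_filter_tailModes_eq (S : Finset (Fin N)) :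
    (Finset.univ.filter fun i : Fin N → Mode d r => tailModes i = S).card =
      r ^ (N - S.card) * (d - r) ^ S.card := by
  have h : (Finset.univ.filter fun i : Fin N → Mode d r => tailModes i = S) =
      Fintype.piFinset fun n =>
        Finset.univ.filter fun a : Mode d r => (a.isRight = true ↔ n ∈ S) := by
    ext i
    simp [tailModes, Finset.ext_iff]
  have hcard : ∀ n, (Finset.univ.filter fun a : Mode d r => (a.isRight = true ↔ n ∈ S)).card =
      if n ∈ S then d - r else r := by
    intro n
    rw [Finset.card_filter, Fintype.sum_sum_type]
    by_cases hn : n ∈ S <;> simp [hn]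
  rw [h, Fintype.card_piFinset, Finset.prod_congr rfl fun n _ => hcard n, Finset.prod_ite,
    Finset.prod_const, Finset.prod_const, mul_comm]
  congr 2
  · rw [Finset.filter_not, Finset.filter_univ_mem,
      Finset.card_sdiff_of_subset (Finset.subset_univ _)]
    simp
  · rw [Finset.filter_univ_mem]

lemma card_filter_tails_lt {k : ℕ} (hk : k ≤ N) :
    (Finset.univ.filter fun i : Fin N → Mode d r => tails i < k).card = qCount N d r k := by
  rw [Finset.card_eq_sum_card_fiberwise (f := tailModes) (t := Finset.univ) (by simp)]
  have h1 : ∀ S : Finset (Fin N),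
      ((Finset.univ.filter fun i : Fin N → Mode d r => tails i < k).filter
        fun i => tailModes i = S).card =
      if S.card < k then r ^ (N - S.card) * (d - r) ^ S.card else 0 := by
    intro S
    rw [Finset.filter_filter]
    split_ifs with hS
    · rw [← card_filter_tailModes_eq S]
      congr 1
      refine Finset.filter_congr fun i _ => and_iff_right_of_imp fun h => ?_
      rwa [← card_tailModes, h]
    · rw [Finset.card_eq_zero, Finset.filter_eq_empty_iff]
      rintro i - ⟨h2, h3⟩
      rw [← card_tailModes, h3] at h2
      exact hS h2
  rw [Finset.sum_congr rfl fun S _ => h1 S, ← Finset.powerset_univ,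
    Finset.sum_powerset_apply_card (fun m => if m < k then r ^ (N - m) * (d - r) ^ m else 0),
    Finset.card_univ, Fintype.card_fin, qCount]
  have hsub : Finset.range k ⊆ Finset.range (N + 1) := Finset.range_mono (by omega)
  rw [← Finset.sum_subset hsub]
  · refine Finset.sum_congr rfl fun m hm => ?_
    rw [if_pos (Finset.mem_range.1 hm), smul_eq_mul, mul_assoc]
  · intro m _ hm
    rw [if_neg (by simpa using hm), smul_zero]

lemma qCount_pos {k : ℕ} (hk : 1 ≤ k) (hr : 1 ≤ r) : 1 ≤ qCount N d r k := by
  calc 1 ≤ N.choose 0 * r ^ (N - 0) * (d - r) ^ 0 := by simpa using Nat.one_le_pow _ _ hr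
    _ ≤ qCount N d r k :=
      Finset.single_le_sum (f := fun i => N.choose i * r ^ (N - i) * (d - r) ^ i)
        (fun _ _ => Nat.zero_le _) (Finset.mem_range.2 hk)

lemma qCount_le {k : ℕ} (hk : 1 ≤ k) (hkN : k ≤ N) (hrd : r ≤ d) :
    qCount N d r k ≤ 2 ^ N * (d ^ (k - 1) * r ^ (N - k + 1)) := by
  calc qCount N d r k
      ≤ ∑ i ∈ Finset.range k, N.choose i * (d ^ (k - 1) * r ^ (N - k + 1)) := by
        refine Finset.sum_le_sum fun i hi => ?_
        have hi' : i < k := Finset.mem_range.1 hi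
        rw [mul_assoc]
        refine Nat.mul_le_mul_left _ ?_
        have h1 : N - i = (k - 1 - i) + (N - k + 1) := by omega
        have h2 : k - 1 = (k - 1 - i) + i := by omega
        calc r ^ (N - i) * (d - r) ^ i = r ^ (k - 1 - i) * (d - r) ^ i * r ^ (N - k + 1) := by
              rw [h1, pow_add]
              ring
          _ ≤ d ^ (k - 1 - i) * d ^ i * r ^ (N - k + 1) := by
              gcongr
              exact Nat.sub_le _ _
          _ = d ^ (k - 1) * r ^ (N - k + 1) := by rw [← pow_add, ← h2]
    _ = (∑ i ∈ Finset.range k, N.choose i) * (d ^ (k - 1) * r ^ (N - k + 1)) := by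
        rw [Finset.sum_mul]
    _ ≤ 2 ^ N * (d ^ (k - 1) * r ^ (N - k + 1)) := by
        refine Nat.mul_le_mul_right _ ?_
        rw [← Nat.sum_range_choose]
        exact Finset.sum_le_sum_of_subset (Finset.range_mono (by omega))

end Counting

section Rank

variable {N d r : ℕ}

lemma le_of_hasMultilinearRank {X : Tensor N (Fin d)} (h : HasMultilinearRank X r) (n : Fin N) :
    r ≤ d := by
  have h1 := Matrix.rank_le_card_height (matricize n X)
  rwa [h n, Fintype.card_fin] at h1

lemma one_le_of_hasMultilinearRank {X : Tensor N (Fin d)} (h : HasMultilinearRank X r) (n : Fin N)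
    (hpos : 0 < minPosSingularValue (matricize n X)) : 1 ≤ r := by
  rw [Nat.one_le_iff_ne_zero]
  rintro rfl
  have h0 : matricize n X = 0 := by
    have h2 : Module.finrank ℝ (LinearMap.range (matricize n X).mulVecLin) = 0 := h n
    rw [Submodule.finrank_eq_zero, LinearMap.range_eq_bot] at h2
    exact (LinearEquiv.map_eq_zero_iff Matrix.toLin').1 h2
  -- The zero matrix has no positive singular value, and `sInf ∅ = 0`.
  have hempty : {s : ℝ | 0 < s ∧ ∃ i : ℕ,
      (Matrix.toEuclideanLin (matricize n X)).singularValues i = s} = ∅ := by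
    ext s
    simp only [h0, map_zero, LinearMap.singularValues_zero, Finsupp.coe_zero, Pi.zero_apply,
      exists_const, Set.mem_ofPred_eq, Set.mem_empty_iff_false, iff_false]
    rintro ⟨h1, rfl⟩
    exact lt_irrefl _ h1
  rw [minPosSingularValue, hempty, Real.sInf_empty] at hpos
  exact lt_irrefl _ hpos

end Rank

section Estimate

variable {N d r : ℕ}

lemma Uperp_transpose_mul_U (E : TuckerEstimate N d r) (n : Fin N) :
    (E.Uperp n)ᵀ * E.U n = 0 := by
  have h := E.orthonormal n
  rw [Matrix.transpose_fromCols, Matrix.fromRows_mul_fromCols, ← Matrix.fromBlocks_one,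
    Matrix.fromBlocks_inj] at h
  exact h.2.2.1

lemma frame_mul_transpose (E : TuckerEstimate N d r) (hr : r ≤ d) (n : Fin N) :
    Matrix.fromCols (E.U n) (E.Uperp n) * (Matrix.fromCols (E.U n) (E.Uperp n))ᵀ = 1 := by
  refine (Matrix.mul_eq_one_comm_of_card_eq _ _ _ ?_).1 (E.orthonormal n)
  simp
  omega

lemma inner_project (E : TuckerEstimate N d r) (hr : r ≤ d) (Y Z : Tensor N (Fin d)) :
    ⟪E.project Y, E.project Z⟫ = ⟪Y, Z⟫ :=
  inner_multiModeProd_of_isometry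
    (fun n => by rw [Matrix.transpose_transpose, frame_mul_transpose E hr n]) Y Z

lemma norm_project (E : TuckerEstimate N d r) (hr : r ≤ d) (Y : Tensor N (Fin d)) :
    ‖E.project Y‖ = ‖Y‖ := by
  rw [norm_eq_sqrt_real_inner, inner_project E hr, ← norm_eq_sqrt_real_inner]

lemma dotProduct_frame_transpose_mulVec (E : TuckerEstimate N d r) (hr : r ≤ d) (n : Fin N)
    (v : Fin d → ℝ) :
    ((Matrix.fromCols (E.U n) (E.Uperp n))ᵀ *ᵥ v) ⬝ᵥ
      ((Matrix.fromCols (E.U n) (E.Uperp n))ᵀ *ᵥ v) = v ⬝ᵥ v := by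
  rw [Matrix.dotProduct_mulVec, Matrix.vecMul_transpose, Matrix.mulVec_mulVec,
    frame_mul_transpose E hr, Matrix.one_mulVec]

lemma dotProduct_Uperp_transpose_mulVec_le (E : TuckerEstimate N d r) (hr : r ≤ d) (n : Fin N)
    (v : Fin d → ℝ) :
    ((E.Uperp n)ᵀ *ᵥ v) ⬝ᵥ ((E.Uperp n)ᵀ *ᵥ v) ≤ v ⬝ᵥ v := by
  rw [← dotProduct_frame_transpose_mulVec E hr n v, Matrix.transpose_fromCols,
    Matrix.fromRows_mulVec, sumElim_dotProduct_sumElim]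
  have : 0 ≤ ((E.U n)ᵀ *ᵥ v) ⬝ᵥ ((E.U n)ᵀ *ᵥ v) :=
    Finset.sum_nonneg fun i _ => mul_self_nonneg _
  linarith

/-- The operator norm is at most the Frobenius norm. -/
lemma dotProduct_mulVec_self_le {m n : Type*} [Fintype m] [Fintype n] (M : Matrix m n ℝ)
    (z : n → ℝ) :
    (M *ᵥ z) ⬝ᵥ (M *ᵥ z) ≤ (∑ j, M.col j ⬝ᵥ M.col j) * (z ⬝ᵥ z) := by
  have h : ∀ a, (M *ᵥ z) a * (M *ᵥ z) a ≤ (∑ j, M a j ^ 2) * ∑ j, z j ^ 2 := by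
    intro a
    rw [← sq]
    exact Finset.sum_mul_sq_le_sq_mul_sq _ _ _
  calc (M *ᵥ z) ⬝ᵥ (M *ᵥ z) ≤ ∑ a, (∑ j, M a j ^ 2) * ∑ j, z j ^ 2 :=
        Finset.sum_le_sum fun a _ => h a
    _ = _ := by
        rw [← Finset.sum_mul, Finset.sum_comm]
        simp [dotProduct, sq]

lemma unfolding_sub {κ : Type*} [Fintype κ] (n : Fin N) (Y Z : Tensor N κ) :
    unfolding n (Y - Z) = unfolding n Y - unfolding n Z := rfl

/-- A perturbation bound for subspaces: `Uperp` almost annihilates the mode-`n` column space of `X`,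
because it annihilates that of the estimate. -/
lemma dotProduct_Uperp_transpose_unfolding_le (E : TuckerEstimate N d r) (hr : r ≤ d)
    {X : Tensor N (Fin d)} {e ω : ℝ} (hω : 0 < ω) (n : Fin N)
    (hX : ω ≤ minPosSingularValue (matricize n X)) (hE : ‖E.tensor - X‖ ≤ e)
    (z : ({m : Fin N // m ≠ n} → Fin d) → ℝ) :
    ((E.Uperp n)ᵀ *ᵥ (unfolding n X *ᵥ z)) ⬝ᵥ ((E.Uperp n)ᵀ *ᵥ (unfolding n X *ᵥ z)) ≤
      (e / ω) ^ 2 * ((unfolding n X *ᵥ z) ⬝ᵥ (unfolding n X *ᵥ z)) := by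
  rw [matricize_eq_unfolding] at hX
  obtain ⟨z', hz1, hz2⟩ := exists_mulVec_eq_of_le_minPosSingularValue hω hX z
  have h0 : (E.Uperp n)ᵀ *ᵥ (unfolding n E.tensor *ᵥ z') = 0 := by
    rw [TuckerEstimate.tensor, unfolding_multiModeProd, Matrix.mulVec_mulVec, ← Matrix.mul_assoc,
      Uperp_transpose_mul_U, Matrix.zero_mul, Matrix.zero_mulVec]
  have h1 : (E.Uperp n)ᵀ *ᵥ (unfolding n X *ᵥ z) =
      (E.Uperp n)ᵀ *ᵥ (unfolding n (X - E.tensor) *ᵥ z') := by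
    rw [unfolding_sub, Matrix.sub_mulVec, Matrix.mulVec_sub, h0, sub_zero, hz1]
  have hzz : 0 ≤ z' ⬝ᵥ z' := Finset.sum_nonneg fun i _ => mul_self_nonneg _
  rw [h1]
  calc _ ≤ (unfolding n (X - E.tensor) *ᵥ z') ⬝ᵥ (unfolding n (X - E.tensor) *ᵥ z') :=
        dotProduct_Uperp_transpose_mulVec_le E hr n _
    _ ≤ ‖X - E.tensor‖ ^ 2 * (z' ⬝ᵥ z') := by
        rw [norm_sq_eq_sum_unfolding n]
        exact dotProduct_mulVec_self_le _ _
    _ ≤ e ^ 2 * (z' ⬝ᵥ z') := by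
        rw [norm_sub_rev]
        gcongr
    _ = (e / ω) ^ 2 * (ω ^ 2 * (z' ⬝ᵥ z')) := by
        field_simp
    _ ≤ _ := by gcongr

/-- The projection matrices with the head coordinates of the modes in `S` deleted. -/
def maskedFrame (E : TuckerEstimate N d r) (S : Finset (Fin N)) (n : Fin N) :
    Matrix (Mode d r) (Fin d) ℝ :=
  if n ∈ S then Matrix.fromRows 0 (E.Uperp n)ᵀ
  else (Matrix.fromCols (E.U n) (E.Uperp n))ᵀ

lemma norm_multiModeProd_maskedFrame_le (E : TuckerEstimate N d r) (hr : r ≤ d)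
    {X : Tensor N (Fin d)} {e ω : ℝ} (hω : 0 < ω)
    (hX : ∀ n, ω ≤ minPosSingularValue (matricize n X)) (hE : ‖E.tensor - X‖ ≤ e)
    (S : Finset (Fin N)) :
    ‖multiModeProd X (maskedFrame E S)‖ ≤ (e / ω) ^ S.card * ‖X‖ := by
  have he : 0 ≤ e := (norm_nonneg _).trans hE
  induction S using Finset.induction_on with
  | empty =>
    have : multiModeProd X (maskedFrame E ∅) = E.project X := by
      rw [TuckerEstimate.project]
      congr 1
    rw [this, norm_project E hr]
    simp
  | insert n S hn ih =>
    rw [Finset.card_insert_of_notMem hn, pow_succ', mul_assoc]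
    refine le_trans ?_ (mul_le_mul_of_nonneg_left ih (by positivity))
    refine norm_multiModeProd_le_of_eq_off (n := n) (fun m hm => ?_) (by positivity) fun z => ?_
    · simp [maskedFrame, hm]
    · have h1 : maskedFrame E (insert n S) n = Matrix.fromRows 0 (E.Uperp n)ᵀ := by
        simp [maskedFrame]
      have h2 : maskedFrame E S n = (Matrix.fromCols (E.U n) (E.Uperp n))ᵀ := by
        simp [maskedFrame, hn]
      rw [h1, h2, dotProduct_frame_transpose_mulVec E hr, Matrix.fromRows_mulVec,
        sumElim_dotProduct_sumElim, Matrix.zero_mulVec, zero_dotProduct, zero_add]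
      exact dotProduct_Uperp_transpose_unfolding_le E hr hω n (hX n) hE z

lemma multiModeProd_maskedFrame_apply (E : TuckerEstimate N d r) (X : Tensor N (Fin d))
    {S : Finset (Fin N)} {i : Fin N → Mode d r} (hS : S ⊆ tailModes i) :
    multiModeProd X (maskedFrame E S) i = E.project X i := by
  rw [TuckerEstimate.project, multiModeProd_apply, multiModeProd_apply]
  refine Finset.sum_congr rfl fun j _ => ?_
  congr 1
  refine Finset.prod_congr rfl fun n _ => ?_
  by_cases hn : n ∈ S
  · have h := hS hn
    simp only [tailModes, Finset.mem_filter, Finset.mem_univ, true_and, Sum.isRight_iff] at h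
    obtain ⟨a, ha⟩ := h
    simp [maskedFrame, hn, ha]
  · simp [maskedFrame, hn]

/-- The entries of the projected tensor with at least `ρ` tails have norm at most `C_⊥`. Every such
entry survives the deletion of the heads in some `ρ` modes. -/
lemma sum_sq_project_le_Cperp (E : TuckerEstimate N d r) (hr : r ≤ d) {X : Tensor N (Fin d)}
    {C e ω : ℝ} (hω : 0 < ω) (hC : ‖X‖ ≤ C)
    (hX : ∀ n, ω ≤ minPosSingularValue (matricize n X)) (hE : ‖E.tensor - X‖ ≤ e) (ρ : ℕ) :
    ∑ i, (if tails i < ρ then 0 else E.project X i ^ 2) ≤ Cperp N ρ C e ω ^ 2 := by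
  have he : 0 ≤ e := (norm_nonneg _).trans hE
  have hsq : ∀ S ∈ Finset.powersetCard ρ (Finset.univ : Finset (Fin N)),
      ∑ i, multiModeProd X (maskedFrame E S) i ^ 2 ≤ ((e / ω) ^ ρ * C) ^ 2 := by
    intro S hS
    have h1 := norm_multiModeProd_maskedFrame_le E hr hω hX hE S
    rw [(Finset.mem_powersetCard.1 hS).2] at h1
    have h2 : ‖multiModeProd X (maskedFrame E S)‖ ≤ (e / ω) ^ ρ * C := h1.trans (by gcongr)
    have h3 := pow_le_pow_left₀ (norm_nonneg _) h2 2
    rw [EuclideanSpace.norm_sq_eq] at h3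
    simpa using h3
  calc ∑ i, (if tails i < ρ then 0 else E.project X i ^ 2)
      ≤ ∑ i, ∑ S ∈ Finset.powersetCard ρ (Finset.univ : Finset (Fin N)),
          multiModeProd X (maskedFrame E S) i ^ 2 := by
        refine Finset.sum_le_sum fun i _ => ?_
        split_ifs with hi
        · exact Finset.sum_nonneg fun S _ => sq_nonneg _
        · rw [not_lt, ← card_tailModes] at hi
          obtain ⟨S, hS1, hS2⟩ := Finset.exists_subset_card_eq hi
          rw [← multiModeProd_maskedFrame_apply E X hS1]
          exact Finset.single_le_sum
            (f := fun S => multiModeProd X (maskedFrame E S) i ^ 2) (fun S _ => sq_nonneg _)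
            (Finset.mem_powersetCard.2 ⟨Finset.subset_univ S, hS2⟩)
    _ = ∑ S ∈ Finset.powersetCard ρ (Finset.univ : Finset (Fin N)),
          ∑ i, multiModeProd X (maskedFrame E S) i ^ 2 := Finset.sum_comm
    _ ≤ ∑ S ∈ Finset.powersetCard ρ (Finset.univ : Finset (Fin N)), ((e / ω) ^ ρ * C) ^ 2 :=
        Finset.sum_le_sum hsq
    _ = N.choose ρ * ((e / ω) ^ ρ * C) ^ 2 := by simp
    _ ≤ 2 ^ N * ((e / ω) ^ ρ * C) ^ 2 := by
        gcongr
        exact_mod_cast Nat.choose_le_two_pow N ρ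
    _ = Cperp N ρ C e ω ^ 2 := by
        have h2 : ((2 : ℝ) ^ ((N : ℝ) / 2)) ^ 2 = 2 ^ N := by
          rw [← Real.rpow_natCast, ← Real.rpow_mul (by norm_num)]
          norm_num
        rw [Cperp, mul_pow, mul_pow, mul_pow, mul_pow, h2, div_pow]
        ring

/-- The true parameter is small in the norm defined by the regularizer. -/
lemma sqrt_quadForm_regMatrix_le {ρ : ℕ} {l lp C Cp : ℝ} (hl : 0 ≤ l) (hlp : 0 ≤ lp) (hC : 0 ≤ C)
    (hCp : 0 ≤ Cp) {y : Tensor N (Mode d r)} (hy : ‖y‖ ≤ C)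
    (hyp : ∑ i, (if tails i < ρ then 0 else y i ^ 2) ≤ Cp ^ 2) :
    √(y.ofLp ⬝ᵥ (regMatrix ρ l lp *ᵥ y.ofLp)) ≤ √l * C + √lp * Cp := by
  refine Real.sqrt_le_iff.2 ⟨by positivity, ?_⟩
  have h1 : y.ofLp ⬝ᵥ (regMatrix ρ l lp *ᵥ y.ofLp) ≤
      l * ∑ i, y i ^ 2 + lp * ∑ i, (if tails i < ρ then 0 else y i ^ 2) := by
    rw [Finset.mul_sum, Finset.mul_sum, ← Finset.sum_add_distrib]
    refine Finset.sum_le_sum fun i _ => ?_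
    rw [regMatrix, Matrix.mulVec_diagonal]
    have := mul_nonneg hl (sq_nonneg (y i))
    split_ifs <;> nlinarith
  have h2 : ∑ i, y i ^ 2 ≤ C ^ 2 := by
    have h3 := pow_le_pow_left₀ (norm_nonneg _) hy 2
    rw [EuclideanSpace.norm_sq_eq] at h3
    simpa using h3
  have h3 : 0 ≤ √l * C * (√lp * Cp) := by positivity
  have h4 : (√l * C) ^ 2 = l * C ^ 2 := by rw [mul_pow, Real.sq_sqrt hl]
  have h5 : (√lp * Cp) ^ 2 = lp * Cp ^ 2 := by rw [mul_pow, Real.sq_sqrt hlp]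
  have h6 := mul_le_mul_of_nonneg_left h2 hl
  have h7 := mul_le_mul_of_nonneg_left hyp hlp
  nlinarith

lemma measurable_project {Ω : Type*} {mΩ : MeasurableSpace Ω} {E : Ω → TuckerEstimate N d r}
    {A : Ω → Tensor N (Fin d)} (hU : ∀ n i j, Measurable fun w => (E w).U n i j)
    (hUp : ∀ n i j, Measurable fun w => (E w).Uperp n i j) (hA : Measurable A) :
    Measurable fun w => (E w).project (A w) := by
  refine (WithLp.measurable_toLp 2 _).comp (measurable_pi_lambda _ fun i => ?_)
  refine Finset.measurable_fun_sum _ fun j _ => ?_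
  refine Measurable.mul (Finset.measurable_fun_prod _ fun n _ => ?_) (by fun_prop)
  rcases i n with a | a
  · exact hU n (j n) a
  · exact hUp n (j n) a

end Estimate

/-! ### The regret bound -/

section Regret

variable {N d r : ℕ}

lemma log_one_add_div_lam_le {T : ℕ} {C : ℝ} (hT : 1 ≤ T) (hC : 0 < C) (hCT : C ≤ √(T : ℝ)) :
    Real.log (1 + T / lam C) ≤ 2 * (1 + Real.log T) := by
  have hT' : (1 : ℝ) ≤ T := by exact_mod_cast hT
  have hC2 : C ^ 2 ≤ T := by
    have := pow_le_pow_left₀ hC.le hCT 2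
    rwa [Real.sq_sqrt (by positivity)] at this
  rw [lam, div_inv_eq_mul]
  calc Real.log (1 + T * C ^ 2) ≤ Real.log (2 * (T : ℝ) ^ 2) := by
        refine Real.log_le_log (by positivity) ?_
        have : (T : ℝ) * C ^ 2 ≤ T ^ 2 := by
          rw [sq (T : ℝ)]
          gcongr
        nlinarith
    _ = Real.log 2 + 2 * Real.log T := by
        rw [Real.log_mul (by norm_num) (by positivity), Real.log_pow]
        norm_num
    _ ≤ _ := by
        have := Real.log_two_lt_d9
        linarith

/-- The regret bound on the event where the self-normalized concentration inequality holds, before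
the parameters are inserted: `D` bounds the log-determinant and `β` the radius of the confidence
sets. -/
lemma regret_le_of_logDet_le {ρ T T1 : ℕ} {C ω δ e D β : ℝ} {X : Tensor N (Fin d)}
    {acts : ℕ → Set (Tensor N (Fin d))} {A : ℕ → Tensor N (Fin d)} {ε : ℕ → ℝ}
    {E : TuckerEstimate N d r} (hr : r ≤ d) (hT1 : T1 ≤ T) (hC : 0 ≤ C) (hXC : ‖X‖ ≤ C)
    (hω : 0 < ω) (hX : ∀ n, ω ≤ minPosSingularValue (matricize n X)) (hE : ‖E.tensor - X‖ ≤ e)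
    (hacts : ∀ t ∈ Finset.Icc 1 T, ∀ B ∈ acts t, ‖B‖ ≤ 1)
    (hl : 0 < lam C) (hlp : 0 < lamPerp N d r ρ T C)
    (hrun : IsTOFURun ρ T T1 C ω δ e acts A (fun t => ⟪A t, X⟫ + ε t) E)
    (hD : ∀ t ≤ T, Real.log
      ((gram (regMatrix ρ (lam C) (lamPerp N d r ρ T C)) T1 (fun τ => E.project (A τ)) t).det /
        (regMatrix (N := N) (d := d) (r := r) ρ (lam C) (lamPerp N d r ρ T C)).det) ≤ D)
    (hβ0 : 0 ≤ β)
    (hβ : ∀ t ≤ T, sqrtBeta (regMatrix ρ (lam C) (lamPerp N d r ρ T C)) T1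
      (fun τ => E.project (A τ)) δ (lam C) (lamPerp N d r ρ T C) C (Cperp N ρ C e ω) t ≤ β)
    (hconc : NoiseConcentrated (regMatrix ρ (lam C) (lamPerp N d r ρ T C)) T1 T
      (fun τ => E.project (A τ)) ε δ) :
    regret X T acts A ≤ 2 * C * T1 + (2 * C + 4 * C * D + 3 * β * √(T * D)) := by
  set lp := lamPerp N d r ρ T C with hlp_def
  set Λ : Matrix (Fin N → Mode d r) (Fin N → Mode d r) ℝ := regMatrix ρ (lam C) lp with hΛ_def
  set b : ℕ → Tensor N (Mode d r) := fun τ => E.project (A τ) with hb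
  have he : 0 ≤ e := (norm_nonneg _).trans hE
  have hΛ : Λ.PosDef := Matrix.PosDef.diagonal fun i => by split_ifs <;> assumption
  have hCp : 0 ≤ Cperp N ρ C e ω := by
    unfold Cperp
    positivity
  set reg : ℕ → ℝ := fun t => sSup ((fun B => ⟪B, X⟫) '' acts t) - ⟪A t, X⟫ with hreg
  have hreg2C : ∀ t ∈ Finset.Icc 1 T, reg t ≤ 2 * C := by
    intro t ht
    have hle : ∀ B ∈ acts t, |⟪B, X⟫| ≤ C := fun B hB =>
      (abs_real_inner_le_norm B X).trans
        ((mul_le_mul (hacts t ht B hB) hXC (norm_nonneg _) zero_le_one).trans_eq (one_mul C))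
    have hmem := hrun.mem t ht
    have h1 : sSup ((fun B => ⟪B, X⟫) '' acts t) ≤ C := by
      refine csSup_le ⟨_, Set.mem_image_of_mem _ hmem⟩ ?_
      rintro _ ⟨B, hB, rfl⟩
      exact (le_abs_self _).trans (hle B hB)
    have h2 := (abs_le.1 (hle _ hmem)).1
    simp only [hreg]
    linarith
  set y := E.project X with hy
  have hyC : ‖y‖ ≤ C := by rwa [hy, norm_project E hr]
  have hyΛ : √(y.ofLp ⬝ᵥ (Λ *ᵥ y.ofLp)) ≤ √(lam C) * C + √lp * Cperp N ρ C e ω :=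
    sqrt_quadForm_regMatrix_le hl.le hlp.le hC hCp hyC
      (sum_sq_project_le_Cperp E hr hω hXC hX hE ρ)
  set u : ℕ → ℝ := fun t => (b t).ofLp ⬝ᵥ ((gram Λ T1 b (t - 1))⁻¹ *ᵥ (b t).ofLp) with hu
  have hu0 : ∀ t, 0 ≤ u t := fun t => by
    have h := (gram_posDef hΛ T1 b (t - 1)).inv.posSemidef.dotProduct_mulVec_nonneg (b t).ofLp
    rwa [star_trivial] at h
  have hwidth : ∀ t ∈ Finset.Ioc (T1 + 1) T, reg t ≤ 2 * β * √(u t) := by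
    intro t ht
    rw [Finset.mem_Ioc] at ht
    -- At the step `T1 + 1` the confidence set is a mere ball, so `t - 1` has to exceed
    -- `T1` for the ellipsoidal bound.
    have htm : T1 < t - 1 := by omega
    have hconf : y ∈ confSet Λ T1 b (fun t => ⟪A t, X⟫ + ε t) δ (lam C) lp C (Cperp N ρ C e ω)
        (t - 1) :=
      mem_confSet hΛ (fun τ _ => by rw [hb, hy, inner_project E hr]) htm hyΛ
        (hconc (t - 1) (by omega) (by omega))
    have hmem := hrun.mem t (Finset.mem_Icc.2 ⟨by omega, ht.2⟩)
    have hopt := hrun.optimistic t (Finset.mem_Icc.2 ⟨by omega, ht.2⟩)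
    have hstep : ∀ B ∈ acts t, ⟪B, X⟫ ≤ ⟪A t, X⟫ + 2 * β * √(u t) := by
      intro B hB
      have h := inner_le_of_optimisticValue_le hΛ htm hconf (x := E.project B)
        (a := E.project (A t)) (hopt hB)
      rw [hy, inner_project E hr, inner_project E hr] at h
      refine h.trans ?_
      have hβt := hβ (t - 1) (by omega)
      simp only [hu]
      gcongr
    have h1 : sSup ((fun B => ⟪B, X⟫) '' acts t) ≤ ⟪A t, X⟫ + 2 * β * √(u t) := by
      refine csSup_le ⟨_, Set.mem_image_of_mem _ hmem⟩ ?_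
      rintro _ ⟨B, hB, rfl⟩
      exact hstep B hB
    simp only [hreg]
    linarith
  have hpot : ∑ t ∈ Finset.Ioc T1 T, Real.log (1 + u t) ≤ D := by
    simp only [hu]
    rw [sum_log_one_add_quadForm hΛ hT1 b]
    exact hD T le_rfl
  have hB := sum_le_of_le_min hC hβ0 hu0
    (fun t ht => hreg2C t (by rw [Finset.mem_Ioc] at ht; rw [Finset.mem_Icc]; omega)) hwidth hpot
  have hA : ∑ t ∈ Finset.Ioc 0 T1, reg t ≤ 2 * C * T1 := by
    calc ∑ t ∈ Finset.Ioc 0 T1, reg t ≤ ∑ t ∈ Finset.Ioc 0 T1, 2 * C :=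
          Finset.sum_le_sum fun t ht => hreg2C t (by
            rw [Finset.mem_Ioc] at ht
            rw [Finset.mem_Icc]
            omega)
      _ = 2 * C * T1 := by
          simp
          ring
  have hsplit : regret X T acts A =
      ∑ t ∈ Finset.Ioc 0 T1, reg t + ∑ t ∈ Finset.Ioc T1 T, reg t := by
    rw [Finset.sum_Ioc_consecutive _ (Nat.zero_le _) hT1]
    rfl
  rw [hsplit]
  exact add_le_add hA hB

/-- The choice of `λ_⊥` balances the two parts of the regret of the optimistic steps: the
log-determinant stays of order `q log (1 + T / λ)`, and the bias `√λ_⊥ C_⊥` in the confidence radius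
costs only `C_⊥ T` in total. -/
lemma phase_cost_le {T C q L ℓ lp Cp : ℝ} (hT : 1 ≤ T) (hCT : C ≤ √T) (hq : 1 ≤ q)
    (hL : 1 ≤ L) (hℓ : 0 < ℓ) (hℓL : ℓ ≤ 2 * L) (hlp : lp = T / (q * ℓ)) (hCp : 0 ≤ Cp) :
    2 * C + 4 * C * (2 * q * ℓ) +
        3 * (√(6 * (q * L)) + 1 + √lp * Cp) * √(T * (2 * q * ℓ)) ≤
      39 * (q * L * √T) + 6 * (Cp * T) := by
  have hqL : 1 ≤ q * L := one_le_mul_of_one_le_of_one_le hq hL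
  have hqℓ : q * ℓ ≤ 2 * (q * L) := by
    have h := mul_le_mul_of_nonneg_left hℓL (by linarith : 0 ≤ q)
    linarith
  have hs0 : 0 ≤ √T := Real.sqrt_nonneg _
  have hTD : √(T * (2 * q * ℓ)) ≤ 2 * √(q * L) * √T := by
    have h4 : √(4 : ℝ) = 2 := by
      rw [show (4 : ℝ) = 2 ^ 2 by norm_num, Real.sqrt_sq (by norm_num)]
    have h : 2 * √(q * L) * √T = √(4 * (q * L) * T) := by
      rw [Real.sqrt_mul (by positivity : 0 ≤ 4 * (q * L)),
        Real.sqrt_mul (by norm_num : (0 : ℝ) ≤ 4) (q * L), h4]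
    rw [h]
    refine Real.sqrt_le_sqrt ?_
    have h := mul_le_mul_of_nonneg_left hqℓ (by linarith : 0 ≤ T)
    linarith
  have hterm1 : √(6 * (q * L)) * √(T * (2 * q * ℓ)) ≤ 5 * (q * L * √T) := by
    have h6 : √(6 * (q * L)) ≤ 5 / 2 * √(q * L) := by
      rw [Real.sqrt_mul (by norm_num)]
      gcongr
      rw [Real.sqrt_le_left (by norm_num)]
      norm_num
    calc √(6 * (q * L)) * √(T * (2 * q * ℓ)) ≤ 5 / 2 * √(q * L) * (2 * √(q * L) * √T) := by gcongr
      _ = 5 * (√(q * L) * √(q * L) * √T) := by ring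
      _ = 5 * (q * L * √T) := by rw [Real.mul_self_sqrt (by positivity)]
  have hterm2 : √(T * (2 * q * ℓ)) ≤ 2 * (q * L * √T) := by
    have h : √(q * L) ≤ q * L := Real.sqrt_le_iff.2 ⟨by positivity, by nlinarith⟩
    calc √(T * (2 * q * ℓ)) ≤ 2 * √(q * L) * √T := hTD
      _ ≤ 2 * (q * L) * √T := by gcongr
      _ = _ := by ring
  have hterm3 : √lp * Cp * √(T * (2 * q * ℓ)) ≤ 2 * (Cp * T) := by
    have h : √lp * √(T * (2 * q * ℓ)) ≤ 2 * T := by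
      have hlp0 : 0 ≤ lp := by
        rw [hlp]
        positivity
      rw [← Real.sqrt_mul hlp0]
      refine Real.sqrt_le_iff.2 ⟨by positivity, ?_⟩
      have h2 : lp * (T * (2 * q * ℓ)) = 2 * T ^ 2 := by
        rw [hlp]
        field_simp
      rw [h2]
      nlinarith
    calc √lp * Cp * √(T * (2 * q * ℓ)) = Cp * (√lp * √(T * (2 * q * ℓ))) := by ring
      _ ≤ Cp * (2 * T) := by gcongr
      _ = _ := by ring
  have hterm4 : C * (q * ℓ) ≤ 2 * (q * L * √T) := by
    calc C * (q * ℓ) ≤ √T * (2 * (q * L)) := by gcongr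
      _ = _ := by ring
  have hterm5 : C ≤ q * L * √T := hCT.trans (le_mul_of_one_le_left hs0 hqL)
  calc 2 * C + 4 * C * (2 * q * ℓ) + 3 * (√(6 * (q * L)) + 1 + √lp * Cp) * √(T * (2 * q * ℓ))
      = 2 * C + 8 * (C * (q * ℓ)) + 3 * (√(6 * (q * L)) * √(T * (2 * q * ℓ))) +
          3 * √(T * (2 * q * ℓ)) + 3 * (√lp * Cp * √(T * (2 * q * ℓ))) := by ring
    _ ≤ _ := by linarith

/-- The regret bound on the event where the noise is concentrated and the estimate is good. -/
lemma regret_le_of_noiseConcentrated {ρ T T1 : ℕ} {C ω δ e : ℝ} {X : Tensor N (Fin d)}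
    {acts : ℕ → Set (Tensor N (Fin d))} {A : ℕ → Tensor N (Fin d)} {ε : ℕ → ℝ}
    {E : TuckerEstimate N d r} (hρ : 1 ≤ ρ) (hρN : ρ ≤ N) (hr1 : 1 ≤ r) (hr : r ≤ d)
    (hT : 1 ≤ T) (hT1 : T1 ≤ T) (hδ : 0 < δ) (hδ1 : δ < 1) (hC : 0 < C) (hCT : C ≤ √(T : ℝ))
    (hXC : ‖X‖ ≤ C) (hω : 0 < ω) (hX : ∀ n, ω ≤ minPosSingularValue (matricize n X))
    (hE : ‖E.tensor - X‖ ≤ e) (hacts : ∀ t ∈ Finset.Icc 1 T, ∀ B ∈ acts t, ‖B‖ ≤ 1)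
    (hrun : IsTOFURun ρ T T1 C ω δ e acts A (fun t => ⟪A t, X⟫ + ε t) E)
    (hconc : NoiseConcentrated (regMatrix ρ (lam C) (lamPerp N d r ρ T C)) T1 T
      (fun τ => E.project (A τ)) ε δ) :
    regret X T acts A ≤ 39 * 2 ^ N * (1 + Real.log T + Real.log (1 / δ)) *
      (C * T1 + (d : ℝ) ^ (ρ - 1) * (r : ℝ) ^ (N - ρ + 1) * √(T : ℝ)
        + C * e ^ ρ * (ω ^ ρ)⁻¹ * T) := by
  have hT' : (1 : ℝ) ≤ T := by exact_mod_cast hT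
  have he : 0 ≤ e := (norm_nonneg _).trans hE
  have hl : 0 < lam C := by
    unfold lam
    positivity
  set ℓ := Real.log (1 + T / lam C) with hℓ_def
  have hℓ : 0 < ℓ := Real.log_pos (by
    have : 0 < T / lam C := by positivity
    linarith)
  set L := 1 + Real.log T + Real.log (1 / δ) with hL_def
  have hlogδ : 0 ≤ Real.log (1 / δ) := Real.log_nonneg (by rw [le_div_iff₀ hδ]; linarith)
  have hlogT : 0 ≤ Real.log T := Real.log_nonneg hT'
  have hL1 : 1 ≤ L := by linarith
  have hℓL : ℓ ≤ 2 * L := (log_one_add_div_lam_le hT hC hCT).trans (by linarith)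
  set q : ℝ := (qCount N d r ρ : ℝ) with hq_def
  have hq1 : 1 ≤ q := Nat.one_le_cast.2 (qCount_pos hρ hr1)
  set lp := lamPerp N d r ρ T C with hlp_def
  have hlp_eq : lp = T / (q * ℓ) := rfl
  have hlp : 0 < lp := by
    rw [hlp_eq]
    positivity
  set Cp := Cperp N ρ C e ω with hCp_def
  have hCp : 0 ≤ Cp := by
    rw [hCp_def, Cperp]
    positivity
  have hnorm : ∀ t ≤ T, ∀ τ ∈ Finset.Ioc T1 t, ‖E.project (A τ)‖ ≤ 1 := by
    intro t ht τ hτ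
    rw [Finset.mem_Ioc] at hτ
    have hmem : τ ∈ Finset.Icc 1 T := Finset.mem_Icc.2 ⟨by omega, by omega⟩
    rw [norm_project E hr]
    exact hacts τ hmem _ (hrun.mem τ hmem)
  have hD : ∀ t ≤ T, Real.log
      ((gram (regMatrix ρ (lam C) lp) T1 (fun τ => E.project (A τ)) t).det /
        (regMatrix (N := N) (d := d) (r := r) ρ (lam C) lp).det) ≤ 2 * q * ℓ := by
    intro t ht
    refine (log_det_gram_div_le (p := fun i : Fin N → Mode d r => tails i < ρ) hl hlp ht
      (hnorm t ht)).trans (le_of_eq ?_)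
    have hdiv : T / lp = q * ℓ := by
      rw [hlp_eq, div_div_cancel₀ (by positivity)]
    rw [card_filter_tails_lt hρN, hdiv, ← hq_def, ← hℓ_def]
    ring
  have hΛ : (regMatrix (N := N) (d := d) (r := r) ρ (lam C) lp).PosDef :=
    Matrix.PosDef.diagonal fun i => by split_ifs <;> assumption
  have hβ : ∀ t ≤ T, sqrtBeta (regMatrix ρ (lam C) lp) T1
      (fun τ => E.project (A τ)) δ (lam C) lp C Cp t ≤ √(6 * (q * L)) + 1 + √lp * Cp := by
    intro t ht
    -- `λ = C⁻²` is chosen to make this part of the radius constant.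
    have h1 : √(lam C) * C = 1 := by
      rw [lam, Real.sqrt_inv, Real.sqrt_sq hC.le, inv_mul_cancel₀ hC.ne']
    have h2 : Real.log ((gram (regMatrix ρ (lam C) lp) T1 (fun τ => E.project (A τ)) t).det /
        ((regMatrix (N := N) (d := d) (r := r) ρ (lam C) lp).det * δ ^ 2)) ≤ 6 * (q * L) := by
      rw [← div_div, Real.log_div (div_pos (gram_posDef hΛ _ _ _).det_pos hΛ.det_pos).ne'
        (by positivity), Real.log_pow]
      have h3 := hD t ht
      have h4 : Real.log (1 / δ) = -Real.log δ := by rw [one_div, Real.log_inv]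
      have h5 : q * ℓ ≤ q * (2 * L) := by gcongr
      have h6 : L ≤ q * L := le_mul_of_one_le_left (by linarith) hq1
      push_cast
      linarith
    rw [sqrtBeta, h1]
    gcongr
  have hmain := regret_le_of_logDet_le hr hT1 hC.le hXC hω hX hE hacts hl hlp hrun hD
    (by positivity) hβ hconc
  set s := √(T : ℝ) with hs_def
  have hs0 : 0 ≤ s := Real.sqrt_nonneg _
  have hsum := hmain.trans (add_le_add_right
    (phase_cost_le hT' hCT hq1 hL1 hℓ hℓL hlp_eq hCp) _)
  have h2N : (1 : ℝ) ≤ 2 ^ N := one_le_pow₀ (by norm_num)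
  set Q : ℝ := (d : ℝ) ^ (ρ - 1) * (r : ℝ) ^ (N - ρ + 1) with hQ_def
  have hqQ : q ≤ 2 ^ N * Q := by
    have := qCount_le (N := N) hρ hρN hr
    rw [hq_def, hQ_def]
    exact_mod_cast this
  set P : ℝ := C * e ^ ρ * (ω ^ ρ)⁻¹ with hP_def
  have hP : 0 ≤ P := by positivity
  have hCpP : Cp ≤ 2 ^ N * P := by
    have h : (2 : ℝ) ^ ((N : ℝ) / 2) ≤ 2 ^ N := by
      rw [← Real.rpow_natCast]
      refine Real.rpow_le_rpow_of_exponent_le (by norm_num) ?_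
      have : (0 : ℝ) ≤ N := Nat.cast_nonneg _
      linarith
    rw [hCp_def, Cperp, hP_def]
    calc (2 : ℝ) ^ ((N : ℝ) / 2) * C * e ^ ρ * (ω ^ ρ)⁻¹
        = (2 : ℝ) ^ ((N : ℝ) / 2) * (C * e ^ ρ * (ω ^ ρ)⁻¹) := by ring
      _ ≤ _ := by gcongr
  have h2NL : 1 ≤ 2 ^ N * L := one_le_mul_of_one_le_of_one_le h2N hL1
  have hfin1 : C * T1 ≤ 2 ^ N * L * (C * T1) := le_mul_of_one_le_left (by positivity) h2NL
  have hfin2 : q * L * s ≤ 2 ^ N * L * (Q * s) := by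
    calc q * L * s ≤ 2 ^ N * Q * L * s := by gcongr
      _ = _ := by ring
  have hfin3 : Cp * T ≤ 2 ^ N * L * (P * T) := by
    calc Cp * T ≤ 2 ^ N * P * T := by gcongr
      _ ≤ 2 ^ N * P * T * L := le_mul_of_one_le_right (by positivity) hL1
      _ = _ := by ring
  have hnn1 : 0 ≤ 2 ^ N * L * (C * T1) := by positivity
  have hnn3 : 0 ≤ 2 ^ N * L * (P * T) := by positivity
  calc regret X T acts A ≤ 2 * C * T1 + (39 * (q * L * s) + 6 * (Cp * T)) := hsum
    _ ≤ 39 * (2 ^ N * L * (C * T1)) + 39 * (2 ^ N * L * (Q * s)) + 39 * (2 ^ N * L * (P * T)) := by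
        linarith
    _ = _ := by ring

end Regret

end TensorBandit

theorem theorem1 (N : ℕ) :
    ∃ (K : ℝ) (p : ℕ), 0 < K ∧
      ∀ (d r ρ T T1 : ℕ) (C ω δ : ℝ) (η : ℕ → ℝ) (X : TensorBandit.Tensor N (Fin d))
        (Ω : Type*) [mΩ : MeasurableSpace Ω] (μ : Measure Ω) [IsProbabilityMeasure μ]
        (ℱ : Filtration ℕ mΩ)
        (acts : ℕ → Ω → Set (TensorBandit.Tensor N (Fin d)))
        (A : ℕ → Ω → TensorBandit.Tensor N (Fin d)) (ε : ℕ → Ω → ℝ)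
        (E : Ω → TensorBandit.TuckerEstimate N d r),
        -- parameters
        1 ≤ ρ → ρ ≤ N → T1 ≤ T → 0 < δ → δ < 1 → 0 < C → C ≤ √(T : ℝ) →
        -- the system tensor
        ‖X‖ ≤ C →
        TensorBandit.HasMultilinearRank X r →
        0 < ω → (∀ n, ω ≤ TensorBandit.minPosSingularValue (TensorBandit.matricize n X)) →
        η T1 ≤ ω →
        -- the bandit problem and the algorithm
        (∀ t ∈ Finset.Icc 1 T, ∀ w, ∀ B ∈ acts t w, ‖B‖ ≤ 1) →
        TensorBandit.IsProtocol μ ℱ T T1 A ε E →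
        (∀ w, TensorBandit.IsTOFURun ρ T T1 C ω δ (η T1) (fun t => acts t w) (fun t => A t w)
          (fun t => ⟪A t w, X⟫ + ε t w) (E w)) →
        -- the estimate is good and the regret exceeds the bound with probability at most `δ`
        μ {w | ‖(E w).tensor - X‖ ≤ η T1 ∧
            K * (1 + Real.log T + Real.log (1 / δ)) ^ p *
                (C * T1 + (d : ℝ) ^ (ρ - 1) * (r : ℝ) ^ (N - ρ + 1) * √(T : ℝ)
                  + C * η T1 ^ ρ * (ω ^ ρ)⁻¹ * T)
              < TensorBandit.regret X T (fun t => acts t w) (fun t => A t w)}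
          ≤ ENNReal.ofReal δ := by
  refine ⟨39 * 2 ^ N, 1, by positivity, ?_⟩
  intro d r ρ T T1 C ω δ η X Ω mΩ μ _ ℱ acts A ε E hρ hρN hT1 hδ hδ1 hC hCT hXC hrank hω hX _ hacts
    hprot hrun
  have hN : 0 < N := by omega
  have hr := TensorBandit.le_of_hasMultilinearRank hrank ⟨0, hN⟩
  have hr1 := TensorBandit.one_le_of_hasMultilinearRank hrank ⟨0, hN⟩ (hω.trans_le (hX _))
  have hT : 1 ≤ T := by
    rw [Nat.one_le_iff_ne_zero]
    rintro rfl
    simp only [Nat.cast_zero, Real.sqrt_zero] at hCT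
    exact absurd hC (not_lt.2 hCT)
  have hl : 0 < TensorBandit.lam C := by
    unfold TensorBandit.lam
    positivity
  have hlp : 0 < TensorBandit.lamPerp N d r ρ T C := by
    have hq : 0 < TensorBandit.qCount N d r ρ := TensorBandit.qCount_pos hρ hr1
    have hpos : 0 < T / TensorBandit.lam C := by positivity
    have hlog : 0 < Real.log (1 + T / TensorBandit.lam C) := Real.log_pos (by linarith)
    unfold TensorBandit.lamPerp
    positivity
  have hΛ : (TensorBandit.regMatrix (N := N) (d := d) (r := r) ρ (TensorBandit.lam C)
      (TensorBandit.lamPerp N d r ρ T C)).PosDef :=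
    Matrix.PosDef.diagonal fun i => by split_ifs <;> assumption
  have hmem : ∀ t ∈ Finset.Ioc T1 T, t ∈ Finset.Icc 1 T := by
    intro t ht
    rw [Finset.mem_Ioc] at ht
    exact Finset.mem_Icc.2 ⟨by omega, ht.2⟩
  have hb : ∀ t ∈ Finset.Ioc T1 T,
      Measurable[ℱ (t - 1)] fun w => (E w).project (A t w) := by
    intro t ht
    have hle : T1 ≤ t - 1 := by
      rw [Finset.mem_Ioc] at ht
      omega
    exact TensorBandit.measurable_project
      (fun n i j => (hprot.U_measurable n i j).mono (ℱ.mono hle) le_rfl)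
      (fun n i j => (hprot.Uperp_measurable n i j).mono (ℱ.mono hle) le_rfl)
      (hprot.action_measurable t (hmem t ht))
  refine (measure_mono ?_).trans (TensorBandit.measure_not_noiseConcentrated_le hΛ hT1 hb
    (fun t ht => hprot.noise_measurable t (hmem t ht))
    (fun t ht => hprot.noise_indep t (hmem t ht))
    (fun t ht => hprot.noise_subgaussian t (hmem t ht)) hδ)
  rintro w ⟨hE, hlt⟩
  intro hconc
  have hle := TensorBandit.regret_le_of_noiseConcentrated hρ hρN hr1 hr hT hT1 hδ hδ1 hC hCT hXC hω
    hX hE (fun t ht => hacts t ht w) (hrun w) hconc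
  rw [pow_one] at hlt
  exact absurd hlt (not_lt.2 hle)
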